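/- **Setting.** Let $\varphi_1,\varphi_2:\mathbb R^p\to\overline{\mathbb R}=\mathbb R\cup\{\infty\}$ and $\varphi=\varphi_1+\varphi_2$. For $\gamma>0$ let $\operatorname{prox}_{\gamma h}(x)=\operatorname{argmin}_w\{h(w)+\frac1{2\gamma}\|w-x\|^2\}$ (minimizers are understood to have finite value), let $\mathrm{DRS}_\gamma(s)$ be the set of pairs $(u,v)$ with $u\in\operatorname{prox}_{\gamma\varphi_1}(s)$ and $v\in\operatorname{prox}_{\gamma\varphi_2}(2u-s)$, and let the Douglas–Rachford envelope be $$\mathrm{DRE}_\gamma(s)=\varphi_1(u)+\varphi_2(v)+\tfrac1\gamma\langle s-u,v-u\rangle+\tfrac1{2\gamma}\|v-u\|^2,\qquad (u,v)\in\mathrm{DRS}_\gamma(s)$$ (under the assumptions below the value does not depend on the choice of $(u,v)$). A point $x$ is stationary for $\varphi$ if $0\in\partial\varphi(x)$ (limiting subdifferential), and a function is level bounded if its sublevel sets at all real levels are bounded. Let $\lambda\in(0,2)$ and $$C_\alpha^{\rm cvx}=\tfrac{\lambda}{(1+\alpha)^2}\Bigl(\tfrac{2-\lambda}2-\alpha\max\{\alpha-\tfrac\lambda2,0\}\Bigr),\qquad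 C_\alpha^{\rm ncvx}=\tfrac{\lambda}{(1+\alpha)^2}\Bigl(\tfrac{2-\lambda}2-\alpha\Bigr).$$ **Assumption DRS (smooth case).** $\varphi_1$ is real valued and differentiable with $L$-Lipschitz gradient ($L\ge0$), $\varphi_2$ is lsc, and $\varphi$ has a minimizer (with finite value). In this case set $\pi=1$, and take $\gamma<1/L$, $0<c<C^{\rm cvx}_{\gamma L}$ if $\varphi_1$ is convex, and $\gamma<\frac{2-\lambda}{2L}$, $0<c<C^{\rm ncvx}_{\gamma L}$ otherwise (with $1/0=\infty$). **Assumption DRS\* (strongly convex case).** $\varphi_1$ is proper, lsc and $\mu$-strongly convex ($\mu>0$), $\varphi_2$ is proper, lsc and convex, and $0\in\operatorname{relint}(\operatorname{dom}\varphi_1-\operatorname{dom}\varphi_2)$. In this case set $\pi=-1$, and take $\gamma>1/\mu$ and $0<c<C^{\rm cvx}_{1/(\gamma\mu)}$. **Algorithm (Linesearch DRS with tolerance $\varepsilon=0$).** Let $i_{\max}\in\mathbb N\cup\{\infty\}$. Start from any $s^0$ and $(u^0,v^0)\in\mathrm{DRS}_\gamma(s^0)$. At iteration $k$ let $r^k=u^k-v^k$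 and stop if $r^k=0$; otherwise set $\bar s^{k+1}=s^k-\lambda r^k$, choose an arbitrary direction $d^k$, and for $i=0,1,2,\dots$ try $\tau=2^{-i}$: compute the candidate $s^{k+1}=(1-\tau)\bar s^{k+1}+\tau(s^k+d^k)$ and $(u^{k+1},v^{k+1})\in\mathrm{DRS}_\gamma(s^{k+1})$, and accept if $\pi\,\mathrm{DRE}_\gamma(s^{k+1})\le\pi\,\mathrm{DRE}_\gamma(s^k)-\frac c\gamma\|r^k\|^2$; if the candidate is not accepted and $i=i_{\max}$, set instead $s^{k+1}=\bar s^{k+1}$ with $(u^{k+1},v^{k+1})\in\mathrm{DRS}_\gamma(\bar s^{k+1})$. If the algorithm stops at iteration $K$, the sequences are extended by $(s^k,u^k,v^k)=(s^K,u^K,v^K)$ for $k>K$. **Theorem (Subsequential convergence of Linesearch DRS).** Suppose that either Assumption DRS or Assumption DRS\* holds, and consider iterates $(s^k,u^k,v^k)_{k\in\mathbb N}$ of the algorithm, with the parameters prescribed in the respective case. Then $\sum_k\|r^k\|^2<\infty$. Moreover: Under Assumption DRS: 1. The sequence $(\mathrm{DRE}_\gamma(s^k))_k$ is nonincreasing and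 converges to some $\varphi_\star\in\mathbb R$. The sequences $(u^k)$ and $(v^k)$ have the same cluster points. Every such cluster point $x$ is stationary for $\varphi$ and satisfies $\varphi(x)=\varphi_\star$; moreover there is a cluster point $\bar s$ of $(s^k)$ with $\operatorname{prox}_{\gamma\varphi_1}(\bar s)=\{x\}$, $(x,x)\in\mathrm{DRS}_\gamma(\bar s)$ and $\mathrm{DRE}_\gamma(\bar s)=\varphi_\star$. 2. If $\varphi$ is level bounded, then $(s^k)$, $(u^k)$ and $(v^k)$ are bounded. Under Assumption DRS\*: 3. $\varphi$ has a unique minimizer $x_\star$, $(\mathrm{DRE}_\gamma(s^k))_k$ is nondecreasing and converges to $\varphi(x_\star)=\min\varphi$, and $(u^k)$ and $(v^k)$ both converge to $x_\star$. 4. The condition $0\in\operatorname{int}(\operatorname{dom}\varphi_1-\operatorname{dom}\varphi_2)$ is equivalent to level boundedness of the dual cost $\psi(y)=\varphi_1^*(-y)+\varphi_2^*(y)$, where $h^*$ denotes the convex conjugate; if it holds, then $(s^k)$ is bounded. -/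

import Mathlib

open Filter Topology
open scoped Pointwise NNReal

noncomputable section

namespace LinesearchDRS

variable {E : Type*} [NormedAddCommGroup E] [InnerProductSpace ℝ E]

/-! ### Extended-real-valued functions

Functions with values in `ℝ ∪ {∞}` are modelled as functions `E → EReal` that never take the
value `⊥`; the latter is part of the assumptions below. -/

/-- The domain of an extended-real-valued function. -/
def dom (h : E → EReal) : Set E := {x | h x < ⊤}

/-- The set of minimizers; with the usual convention it is contained in the domain
(and is therefore empty if `h` is identically `∞`). -/
def argmin (h : E → EReal) : Set E := {x | x ∈ dom h ∧ ∀ y, h x ≤ h y}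

/-- All sublevel sets at real levels are bounded. -/
def LevelBounded (h : E → EReal) : Prop :=
  ∀ α : ℝ, Bornology.IsBounded {x | h x ≤ (α : EReal)}

/-- Convexity of an extended-real-valued function (with values different from `⊥`). -/
def IsConvexFun (h : E → EReal) : Prop :=
  ∀ x y : E, ∀ a b : ℝ, 0 < a → 0 < b → a + b = 1 →
    h (a • x + b • y) ≤ (a : EReal) * h x + (b : EReal) * h y

/-- `μ`-strong convexity: `h - (μ / 2) ‖·‖ ^ 2` is convex. -/
def IsStronglyConvexFun (μ : ℝ) (h : E → EReal) : Prop :=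
  IsConvexFun fun x => h x - ((μ / 2 * ‖x‖ ^ 2 : ℝ) : EReal)

/-- Proper, lower semicontinuous, with values in `ℝ ∪ {∞}`. -/
structure IsProperLsc (h : E → EReal) : Prop where
  ne_bot : ∀ x, h x ≠ ⊥
  nonempty_dom : (dom h).Nonempty
  lsc : LowerSemicontinuous h

/-- The regular subdifferential of `h` at `x`. -/
def regularSubdifferential (h : E → EReal) (x : E) : Set E :=
  {w | x ∈ dom h ∧
    0 ≤ liminf (fun y => (h y - h x - ((inner ℝ w (y - x) : ℝ) : EReal)) /
      ((‖y - x‖ : ℝ) : EReal)) (𝓝[≠] x)}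

/-- The limiting subdifferential of `h` at `x`. -/
def subdifferential (h : E → EReal) (x : E) : Set E :=
  {w | x ∈ dom h ∧ ∃ (xs ws : ℕ → E), (∀ k, ws k ∈ regularSubdifferential h (xs k)) ∧
    Tendsto xs atTop (𝓝 x) ∧ Tendsto (fun k => h (xs k)) atTop (𝓝 (h x)) ∧
    Tendsto ws atTop (𝓝 w)}

/-- `x` is stationary for `h`. -/
def IsStationary (h : E → EReal) (x : E) : Prop := (0 : E) ∈ subdifferential h x

/-- The convex conjugate. -/
def conj (h : E → EReal) (y : E) : EReal := ⨆ x, (((inner ℝ y x : ℝ) : EReal) - h x)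

/-- The dual cost `ψ`: the sum of the conjugates of `φ₁(-·)` and of `φ₂`. -/
def dualCost (φ₁ φ₂ : E → EReal) (y : E) : EReal := conj (fun x => φ₁ (-x)) y + conj φ₂ y

/-! ### Douglas-Rachford splitting -/

/-- The (set-valued) proximal mapping of `h` with parameter `γ`. -/
def prox (γ : ℝ) (h : E → EReal) (x : E) : Set E :=
  argmin fun w => h w + ((1 / (2 * γ) * ‖w - x‖ ^ 2 : ℝ) : EReal)

/-- The DRS oracle at `s`: all pairs `(u, v)` with `u ∈ prox_{γ φ₁}(s)` and
`v ∈ prox_{γ φ₂}(2u - s)`. -/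
def drs (φ₁ φ₂ : E → EReal) (γ : ℝ) (s : E) : Set (E × E) :=
  {w | w.1 ∈ prox γ φ₁ s ∧ w.2 ∈ prox γ φ₂ ((2 : ℝ) • w.1 - s)}

/-- The Douglas-Rachford envelope at `s`, evaluated through a pair `(u, v) ∈ drs φ₁ φ₂ γ s`. -/
def dre (φ₁ φ₂ : E → EReal) (γ : ℝ) (s u v : E) : EReal :=
  φ₁ u + φ₂ v +
    ((1 / γ * inner ℝ (s - u) (v - u) + 1 / (2 * γ) * ‖v - u‖ ^ 2 : ℝ) : EReal)

/-! ### The two sets of assumptions -/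

/-- The smooth case: `φ₁` is real valued with `L`-Lipschitz gradient, `φ₂` is lsc, and
`φ₁ + φ₂` has a minimizer. -/
structure SmoothCase [CompleteSpace E] (φ₁ φ₂ : E → EReal) (L : ℝ≥0) : Prop where
  smooth : ∃ f : E → ℝ, (∀ x, φ₁ x = (f x : EReal)) ∧ Differentiable ℝ f ∧
    LipschitzWith L (gradient f)
  ne_bot : ∀ x, φ₂ x ≠ ⊥
  lsc : LowerSemicontinuous φ₂
  solution : (argmin (φ₁ + φ₂)).Nonempty

/-- The strongly convex case. -/
structure StronglyConvexCase (φ₁ φ₂ : E → EReal) (μ : ℝ) : Prop where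
  pos : 0 < μ
  proper₁ : IsProperLsc φ₁
  strong : IsStronglyConvexFun μ φ₁
  proper₂ : IsProperLsc φ₂
  convex : IsConvexFun φ₂
  qualification : (0 : E) ∈ intrinsicInterior ℝ (dom φ₁ - dom φ₂)

/-! ### The linesearch algorithm -/

open Classical in
/-- The decrease constant `C_α(lam)`; `cvx` tells whether the smooth function is convex. -/
def decreaseConst (cvx : Prop) (α lam : ℝ) : ℝ :=
  lam / (1 + α) ^ 2 * ((2 - lam) / 2 - α * (if cvx then max (α - lam / 2) 0 else 1))

/-- The stepsize condition in the smooth case: `γ < 1 / L` if `φ₁` is convex and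
`γ < (2 - lam) / (2 L)` otherwise, with `1 / 0 = ∞`. -/
def StepsizeCond (φ₁ : E → EReal) (L : ℝ≥0) (γ lam : ℝ) : Prop :=
  (IsConvexFun φ₁ → γ * L < 1) ∧ (¬ IsConvexFun φ₁ → γ * (2 * L) < 2 - lam)

/-- The acceptance test for a candidate `(s', u', v')` at the current iterate `(s, u, v)`. -/
def Accept (φ₁ φ₂ : E → EReal) (π γ c : ℝ) (s u v s' u' v' : E) : Prop :=
  (π : EReal) * dre φ₁ φ₂ γ s' u' v' ≤
    (π : EReal) * dre φ₁ φ₂ γ s u v - ((c / γ * ‖u - v‖ ^ 2 : ℝ) : EReal)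

/-- The nominal DRS update. -/
def nominal (lam : ℝ) (s u v : E) : E := s - lam • (u - v)

/-- The candidate update after `j` backtrackings, with `τ = 2⁻ʲ` and direction `d`. -/
def candidate (lam : ℝ) (s u v d : E) (j : ℕ) : E :=
  (1 - (1 / 2 : ℝ) ^ j) • nominal lam s u v + ((1 / 2 : ℝ) ^ j) • (s + d)

/-- One iteration from `(s, u, v)` to `(s', u', v')` with direction `d`: the candidates
`0, 1, …, i` are tested in order, the pairs `(uc j, vc j)` being the outputs of the oracle that are
used to evaluate the envelope. Either the `i`-th one is the first to be accepted, or none has been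
accepted with `i` the maximum number of backtrackings, and a nominal step is taken. -/
def Step (φ₁ φ₂ : E → EReal) (π γ lam c : ℝ) (imax : ℕ∞) (d s u v s' u' v' : E) : Prop :=
  ∃ (i : ℕ) (uc vc : ℕ → E), (i : ℕ∞) ≤ imax ∧
    (∀ j ≤ i, (uc j, vc j) ∈ drs φ₁ φ₂ γ (candidate lam s u v d j)) ∧
    (∀ j < i, ¬ Accept φ₁ φ₂ π γ c s u v (candidate lam s u v d j) (uc j) (vc j)) ∧
    ((Accept φ₁ φ₂ π γ c s u v (candidate lam s u v d i) (uc i) (vc i) ∧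
        s' = candidate lam s u v d i ∧ u' = uc i ∧ v' = vc i) ∨
      (¬ Accept φ₁ φ₂ π γ c s u v (candidate lam s u v d i) (uc i) (vc i) ∧
        (i : ℕ∞) = imax ∧ s' = nominal lam s u v ∧ (u', v') ∈ drs φ₁ φ₂ γ s'))

/-- `(s, u, v)` are iterates of the linesearch DRS algorithm with sign `π`, stepsize `γ`,
relaxation `lam`, decrease constant `c`, tolerance `ε`, at most `imax` backtrackings per iteration,
and arbitrary directions. If the stopping criterion is met at iteration `k`, the sequences are
constant from there on. -/
structure IsRun (φ₁ φ₂ : E → EReal) (π γ lam c ε : ℝ) (imax : ℕ∞) (s u v : ℕ → E) : Prop where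
  init : (u 0, v 0) ∈ drs φ₁ φ₂ γ (s 0)
  halt : ∀ k, 1 / γ * ‖u k - v k‖ ≤ ε →
    s (k + 1) = s k ∧ u (k + 1) = u k ∧ v (k + 1) = v k
  step : ∀ k, ε < 1 / γ * ‖u k - v k‖ →
    ∃ d, Step φ₁ φ₂ π γ lam c imax d (s k) (u k) (v k) (s (k + 1)) (u (k + 1)) (v (k + 1))

end LinesearchDRS

end

open Filter Topology
open scoped Pointwise NNReal

noncomputable section

set_option linter.unusedSectionVars false

namespace LinesearchDRS

variable {E : Type*} [NormedAddCommGroup E] [InnerProductSpace ℝ E]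

/-! ### Real-valued reformulations -/

/-! The sign times the envelope is a Lyapunov function: nominal steps decrease it by at least `c / γ
* ‖r‖ ^ 2`. A linesearch step either passes this very test or is nominal, so arbitrary directions do
no harm, and a lower bound yields summability by telescoping.

Smooth case. Optimality gives `s = u + γ • ∇f(u)`, so the envelope is the minimum over `w` of `f u +
⟪∇f u, w - u⟫ + φ₂ w + ‖w - u‖² / (2γ)`. For `γL < 1` it dominates the cost at `v`, hence `min φ`.
Comparing `v'` with `v` in this minimum (`smooth_envelope_change`) leaves a Bregman distance and two
squares, controlled by cocoercivity or the descent lemma. At cluster points, lower semicontinuity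
and minimality of `v` pin down the value (`limit_of_subsequence`).

Strongly convex case. The prox inequalities give the increase directly, without passing through the
dual (`strong_envelope_change`), and show that the envelope lies below `φ` with a quadratic gap at
`u` (`dreReal_add_le_of_strong`). The gap bounds `u`, but `s` may be unbounded. Still, `s - u` is
bounded on the span of `dom φ₁ - dom φ₂`, by the relative interior condition and uniform boundedness
(`exists_bound_on_span`), and `u - v` lies in that set. So the cross term of the envelope vanishes,
the limit value is attained, and the gap forces `u` to converge to the minimizer. -/

/-- The real value of the Douglas-Rachford envelope. -/
def dreReal (φ₁ φ₂ : E → EReal) (γ : ℝ) (s u v : E) : ℝ :=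
  (φ₁ u).toReal + (φ₂ v).toReal +
    (1 / γ * inner ℝ (s - u) (v - u) + 1 / (2 * γ) * ‖v - u‖ ^ 2)

theorem mem_dom_iff {h : E → EReal} {x : E} : x ∈ dom h ↔ h x ≠ ⊤ := by
  rw [dom, Set.mem_ofPred_eq, lt_top_iff_ne_top]

theorem coe_toReal_of_mem_dom {h : E → EReal} (hb : ∀ x, h x ≠ ⊥) {x : E} (hx : x ∈ dom h) :
    ((h x).toReal : EReal) = h x :=
  EReal.coe_toReal (mem_dom_iff.1 hx) (hb x)

theorem mem_dom_of_eq_coe {h : E → EReal} {x : E} {a : ℝ} (hx : h x = a) : x ∈ dom h := by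
  rw [mem_dom_iff, hx]; exact EReal.coe_ne_top a

theorem mem_dom_add {h₁ h₂ : E → EReal} (hb₁ : ∀ x, h₁ x ≠ ⊥) (hb₂ : ∀ x, h₂ x ≠ ⊥) {x : E} :
    x ∈ dom (h₁ + h₂) ↔ x ∈ dom h₁ ∧ x ∈ dom h₂ := by
  simp only [mem_dom_iff, Pi.add_apply]
  refine ⟨fun h => ⟨fun h1 => h ?_, fun h2 => h ?_⟩, fun h => EReal.add_ne_top h.1 h.2⟩
  · rw [h1, EReal.top_add_of_ne_bot (hb₂ x)]
  · rw [h2, EReal.add_top_of_ne_bot (hb₁ x)]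

theorem add_ne_bot {h₁ h₂ : E → EReal} (hb₁ : ∀ x, h₁ x ≠ ⊥) (hb₂ : ∀ x, h₂ x ≠ ⊥) (x : E) :
    (h₁ + h₂) x ≠ ⊥ := by
  simp [EReal.add_eq_bot_iff, hb₁ x, hb₂ x]

theorem toReal_add_of_mem_dom {h₁ h₂ : E → EReal} (hb₁ : ∀ x, h₁ x ≠ ⊥) (hb₂ : ∀ x, h₂ x ≠ ⊥)
    {x : E} (hx₁ : x ∈ dom h₁) (hx₂ : x ∈ dom h₂) :
    (h₁ + h₂) x = (((h₁ x).toReal + (h₂ x).toReal : ℝ) : EReal) := by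
  rw [EReal.coe_add, coe_toReal_of_mem_dom hb₁ hx₁, coe_toReal_of_mem_dom hb₂ hx₂, Pi.add_apply]

theorem mem_argmin_iff {h : E → EReal} (hb : ∀ x, h x ≠ ⊥) {x : E} :
    x ∈ argmin h ↔ x ∈ dom h ∧ ∀ y ∈ dom h, (h x).toReal ≤ (h y).toReal := by
  refine and_congr_right fun hx => ⟨fun H y hy => ?_, fun H y => ?_⟩
  · exact EReal.toReal_le_toReal (H y) (hb x) (mem_dom_iff.1 hy)
  · by_cases hy : y ∈ dom h
    · rw [← coe_toReal_of_mem_dom hb hx, ← coe_toReal_of_mem_dom hb hy]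
      exact EReal.coe_le_coe_iff.2 (H y hy)
    · rw [mem_dom_iff, not_not] at hy
      rw [hy]; exact le_top

theorem mem_prox_iff {h : E → EReal} (hb : ∀ x, h x ≠ ⊥) {γ : ℝ} {u s : E} :
    u ∈ prox γ h s ↔ u ∈ dom h ∧ ∀ w ∈ dom h,
      (h u).toReal + 1 / (2 * γ) * ‖u - s‖ ^ 2 ≤ (h w).toReal + 1 / (2 * γ) * ‖w - s‖ ^ 2 := by
  have hb' : ∀ x : E, ((1 / (2 * γ) * ‖x - s‖ ^ 2 : ℝ) : EReal) ≠ ⊥ := fun x => EReal.coe_ne_bot _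
  have hd' : ∀ x : E, x ∈ dom fun x : E => ((1 / (2 * γ) * ‖x - s‖ ^ 2 : ℝ) : EReal) :=
    fun x => mem_dom_of_eq_coe rfl
  have key := mem_argmin_iff (add_ne_bot hb hb') (x := u)
  simp only [mem_dom_add hb hb', hd', and_true] at key
  change u ∈ argmin (h + fun x : E => ((1 / (2 * γ) * ‖x - s‖ ^ 2 : ℝ) : EReal)) ↔ _
  rw [key]
  refine and_congr_right fun hu => forall₂_congr fun w hw => ?_
  rw [toReal_add_of_mem_dom hb hb' hu (hd' u), toReal_add_of_mem_dom hb hb' hw (hd' w)]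
  simp only [EReal.toReal_coe]

theorem dre_eq_coe {φ₁ φ₂ : E → EReal} (hb₁ : ∀ x, φ₁ x ≠ ⊥) (hb₂ : ∀ x, φ₂ x ≠ ⊥) {γ : ℝ}
    {s u v : E} (hu : u ∈ dom φ₁) (hv : v ∈ dom φ₂) :
    dre φ₁ φ₂ γ s u v = (dreReal φ₁ φ₂ γ s u v : EReal) := by
  unfold dre dreReal
  rw [EReal.coe_add (_ + _) (_ + _), EReal.coe_add (φ₁ u).toReal, coe_toReal_of_mem_dom hb₁ hu,
    coe_toReal_of_mem_dom hb₂ hv]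

theorem dom_of_mem_drs {φ₁ φ₂ : E → EReal} (hb₁ : ∀ x, φ₁ x ≠ ⊥) (hb₂ : ∀ x, φ₂ x ≠ ⊥) {γ : ℝ}
    {s u v : E} (h : (u, v) ∈ drs φ₁ φ₂ γ s) : u ∈ dom φ₁ ∧ v ∈ dom φ₂ :=
  ⟨((mem_prox_iff hb₁).1 h.1).1, ((mem_prox_iff hb₂).1 h.2).1⟩

theorem dre_eq_coe_of_mem_drs {φ₁ φ₂ : E → EReal} (hb₁ : ∀ x, φ₁ x ≠ ⊥) (hb₂ : ∀ x, φ₂ x ≠ ⊥)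
    {γ : ℝ} {s u v : E} (h : (u, v) ∈ drs φ₁ φ₂ γ s) :
    dre φ₁ φ₂ γ s u v = (dreReal φ₁ φ₂ γ s u v : EReal) :=
  dre_eq_coe hb₁ hb₂ (dom_of_mem_drs hb₁ hb₂ h).1 (dom_of_mem_drs hb₁ hb₂ h).2

/-! ### Monotonicity of the envelope along a run -/

theorem IsRun.mem_drs {φ₁ φ₂ : E → EReal} {π γ lam c ε : ℝ} {imax : ℕ∞} {s u v : ℕ → E}
    (h : IsRun φ₁ φ₂ π γ lam c ε imax s u v) (k : ℕ) : (u k, v k) ∈ drs φ₁ φ₂ γ (s k) := by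
  induction k with
  | zero => exact h.init
  | succ k ih =>
    rcases le_or_gt (1 / γ * ‖u k - v k‖) ε with hk | hk
    · obtain ⟨h1, h2, h3⟩ := h.halt k hk
      rw [h1, h2, h3]; exact ih
    · obtain ⟨d, i, uc, vc, -, hmem, -, ⟨-, h1, h2, h3⟩ | ⟨-, -, -, h3⟩⟩ := h.step k hk
      · rw [h1, h2, h3]; exact hmem i le_rfl
      · exact h3

/-- If nominal steps decrease `π` times the envelope enough, then so do all steps of a run. -/
theorem IsRun.decrease {φ₁ φ₂ : E → EReal} (hb₁ : ∀ x, φ₁ x ≠ ⊥) (hb₂ : ∀ x, φ₂ x ≠ ⊥)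
    {π γ lam c : ℝ} (hγ : 0 < γ) {imax : ℕ∞} {s u v : ℕ → E}
    (h : IsRun φ₁ φ₂ π γ lam c 0 imax s u v)
    (hnom : ∀ s u v u' v', (u, v) ∈ drs φ₁ φ₂ γ s →
      (u', v') ∈ drs φ₁ φ₂ γ (nominal lam s u v) →
      π * dreReal φ₁ φ₂ γ (nominal lam s u v) u' v' ≤
        π * dreReal φ₁ φ₂ γ s u v - c / γ * ‖u - v‖ ^ 2) (k : ℕ) :
    π * dreReal φ₁ φ₂ γ (s (k + 1)) (u (k + 1)) (v (k + 1)) ≤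
      π * dreReal φ₁ φ₂ γ (s k) (u k) (v k) - c / γ * ‖u k - v k‖ ^ 2 := by
  rcases le_or_gt (1 / γ * ‖u k - v k‖) 0 with hk | hk
  -- With tolerance zero, stopping means a zero residual, so the constant continuation meets the
  -- bound.
  · obtain ⟨h1, h2, h3⟩ := h.halt k hk
    have h0 : ‖u k - v k‖ = 0 := by
      have : 0 < 1 / γ := by positivity
      nlinarith [norm_nonneg (u k - v k)]
    rw [h1, h2, h3, h0]; simp
  · obtain ⟨d, i, uc, vc, -, hmem, -, ⟨hacc, h1, h2, h3⟩ | ⟨-, -, h1, h3⟩⟩ := h.step k hk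
    · rw [← h1, ← h2, ← h3, Accept, dre_eq_coe_of_mem_drs hb₁ hb₂ (h.mem_drs (k + 1)),
        dre_eq_coe_of_mem_drs hb₁ hb₂ (h.mem_drs k)] at hacc
      exact_mod_cast hacc
    · rw [h1] at h3 ⊢
      exact hnom _ _ _ _ _ (h.mem_drs k) h3

/-- Telescoping: `κ * ∑ q` never exceeds `a 0 - B`. -/
theorem summable_and_antitone_of_decrease {a q : ℕ → ℝ} {κ B : ℝ} (hκ : 0 < κ) (hq : ∀ k, 0 ≤ q k)
    (hB : ∀ k, B ≤ a k) (ha : ∀ k, a (k + 1) ≤ a k - κ * q k) :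
    Summable q ∧ Antitone a ∧ ∃ l, Tendsto a atTop (𝓝 l) := by
  have hanti : Antitone a := antitone_nat_of_succ_le fun k => by
    nlinarith [ha k, mul_nonneg hκ.le (hq k)]
  refine ⟨summable_of_sum_range_le (c := (a 0 - B) / κ) hq fun n => ?_, hanti, _,
    tendsto_atTop_ciInf hanti ⟨B, by rintro _ ⟨k, rfl⟩; exact hB k⟩⟩
  have : ∀ n, κ * ∑ i ∈ Finset.range n, q i ≤ a 0 - a n := by
    intro n
    induction n with
    | zero => simp
    | succ n ih => rw [Finset.sum_range_succ]; linarith [ha n]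
  rw [le_div_iff₀ hκ]
  linarith [this n, hB n]

theorem tendsto_of_summable_norm_sq {r : ℕ → E} (h : Summable fun k => ‖r k‖ ^ 2) :
    Tendsto r atTop (𝓝 0) := by
  have h1 := (Real.continuous_sqrt.tendsto 0).comp h.tendsto_atTop_zero
  simp only [Real.sqrt_zero] at h1
  refine tendsto_zero_iff_norm_tendsto_zero.2 (h1.congr fun k => ?_)
  simp

/-- The triangle inequality `lam * ‖r‖ ≤ (1 + α) * ‖e‖` is the origin of the factor `lam / (1 + α) ^
2`. The increments of `u` and of `s - u` play `e` and `d` in the smooth case, and swap roles in the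
strongly convex one. -/
theorem norm_sq_residual_le {lam α B : ℝ} {d e r : E} (hlam : 0 < lam) (hα : 0 ≤ α) (hB : 0 ≤ B)
    (hr : lam • r = d + e) (hd : ‖d‖ ≤ α * ‖e‖) :
    lam / (1 + α) ^ 2 * B * ‖r‖ ^ 2 ≤ B / lam * ‖e‖ ^ 2 := by
  have h1 : lam * ‖r‖ ≤ (1 + α) * ‖e‖ := by
    calc lam * ‖r‖ = ‖lam • r‖ := by rw [norm_smul, Real.norm_of_nonneg hlam.le]
      _ ≤ ‖d‖ + ‖e‖ := by rw [hr]; exact norm_add_le _ _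
      _ ≤ _ := by linarith
  have h2 : (lam * ‖r‖) ^ 2 ≤ ((1 + α) * ‖e‖) ^ 2 := pow_le_pow_left₀ (by positivity) h1 2
  calc lam / (1 + α) ^ 2 * B * ‖r‖ ^ 2 = B / (lam * (1 + α) ^ 2) * (lam * ‖r‖) ^ 2 := by
        field_simp
    _ ≤ B / (lam * (1 + α) ^ 2) * ((1 + α) * ‖e‖) ^ 2 := by gcongr
    _ = B / lam * ‖e‖ ^ 2 := by field_simp

/-- The decrease constant is at most the quadratic form that governs nominal steps. -/
theorem decrease_le_of_norm_le {lam α c : ℝ} {d e r : E} (hlam : 0 < lam) (hα : 0 ≤ α) (hc : 0 < c)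
    {B : ℝ} (hcB : c < lam / (1 + α) ^ 2 * B) (hr : lam • r = d + e) (hd : ‖d‖ ≤ α * ‖e‖) :
    c * ‖r‖ ^ 2 ≤ B / lam * ‖e‖ ^ 2 := by
  have hB : 0 ≤ B := by
    by_contra! hB
    have : lam / (1 + α) ^ 2 * B ≤ 0 := mul_nonpos_of_nonneg_of_nonpos (by positivity) hB.le
    linarith
  exact (mul_le_mul_of_nonneg_right hcB.le (sq_nonneg _)).trans
    (norm_sq_residual_le hlam hα hB hr hd)

theorem isBounded_range_add {x y z : ℕ → E} (hx : Bornology.IsBounded (Set.range x))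
    (hy : Bornology.IsBounded (Set.range y)) (h : ∀ k, z k = x k + y k) :
    Bornology.IsBounded (Set.range z) := by
  refine (hx.add hy).subset ?_
  rintro _ ⟨k, rfl⟩
  rw [h]; exact Set.add_mem_add ⟨k, rfl⟩ ⟨k, rfl⟩

/-! ### Functions with Lipschitz gradient -/

section Smooth

variable [CompleteSpace E]

theorem hasDerivAt_comp_line {f : E → ℝ} (hf : Differentiable ℝ f) (x d : E) (t : ℝ) :
    HasDerivAt (fun t : ℝ => f (x + t • d)) (inner ℝ (gradient f (x + t • d)) d) t := by
  have h1 : HasDerivAt (fun t : ℝ => x + t • d) d t := by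
    simpa using ((hasDerivAt_id t).smul_const d).const_add x
  have h2 := (hf (x + t • d)).hasFDerivAt.comp_hasDerivAt t h1
  rw [inner_gradient_left]
  exact h2

/-- The descent lemma. -/
theorem sub_le_of_lipschitz_gradient {f : E → ℝ} (hf : Differentiable ℝ f) {L : ℝ≥0}
    (hL : LipschitzWith L (gradient f)) (x y : E) :
    f y ≤ f x + inner ℝ (gradient f x) (y - x) + L / 2 * ‖y - x‖ ^ 2 := by
  set d := y - x with hd
  -- The excess of `f` over its quadratic model along the segment; it is nonincreasing for `t ≥ 0`.
  let F : ℝ → ℝ := fun t =>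
    f (x + t • d) - (t * inner ℝ (gradient f x) d + L / 2 * ‖d‖ ^ 2 * t ^ 2)
  have hF : ∀ t, HasDerivAt F (inner ℝ (gradient f (x + t • d)) d -
      (1 * inner ℝ (gradient f x) d + L / 2 * ‖d‖ ^ 2 * (2 * t))) t := fun t =>
    (hasDerivAt_comp_line hf x d t).sub (((hasDerivAt_id t).mul_const _).add
      (by simpa using (hasDerivAt_pow 2 t).const_mul (L / 2 * ‖d‖ ^ 2 : ℝ)))
  have hanti : AntitoneOn F (Set.Ici 0) := by
    refine antitoneOn_of_deriv_nonpos (convex_Ici 0)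
      (fun t _ => (hF t).continuousAt.continuousWithinAt)
      (fun t _ => (hF t).differentiableAt.differentiableWithinAt) fun t ht => ?_
    rw [interior_Ici, Set.mem_Ioi] at ht
    rw [(hF t).deriv]
    have h1 : inner ℝ (gradient f (x + t • d) - gradient f x) d ≤ L * (t * ‖d‖) * ‖d‖ := by
      refine (real_inner_le_norm _ _).trans (mul_le_mul_of_nonneg_right ?_ (norm_nonneg _))
      have := hL.norm_sub_le (x + t • d) x
      rwa [add_sub_cancel_left, norm_smul, Real.norm_of_nonneg ht.le] at this
    rw [inner_sub_left] at h1
    nlinarith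
  have h := hanti (Set.mem_Ici.2 le_rfl) (Set.mem_Ici.2 zero_le_one) zero_le_one
  simp only [F, one_smul, zero_smul, hd, add_sub_cancel, add_zero] at h
  linarith

theorem gradient_fun_neg (f : E → ℝ) : gradient (fun x => -f x) = fun x => -gradient f x := by
  funext x
  simp [gradient, fderiv_fun_neg]

theorem sub_ge_of_lipschitz_gradient {f : E → ℝ} (hf : Differentiable ℝ f) {L : ℝ≥0}
    (hL : LipschitzWith L (gradient f)) (x y : E) :
    f x + inner ℝ (gradient f x) (y - x) - L / 2 * ‖y - x‖ ^ 2 ≤ f y := by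
  have h := sub_le_of_lipschitz_gradient (f := fun x => -f x) hf.neg
    (by rw [gradient_fun_neg]; exact hL.neg) x y
  rw [gradient_fun_neg, inner_neg_left] at h
  linarith

/-- The gradient inequality for convex functions. -/
theorem gradient_inequality {f : E → ℝ} (hf : Differentiable ℝ f) (hc : ConvexOn ℝ Set.univ f)
    (x y : E) : f x + inner ℝ (gradient f x) (y - x) ≤ f y := by
  have hc' : ConvexOn ℝ Set.univ fun t : ℝ => f (x + t • (y - x)) := by
    have := hc.comp_affineMap (AffineMap.lineMap x y : ℝ →ᵃ[ℝ] E)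
    refine this.congr fun t _ => ?_
    simp [AffineMap.lineMap_apply, add_comm]
  have h := hc'.deriv_le_slope (Set.mem_univ 0) (Set.mem_univ 1) zero_lt_one
    (hasDerivAt_comp_line hf x (y - x) 0).differentiableAt
  rw [(hasDerivAt_comp_line hf x (y - x) 0).deriv] at h
  simp only [slope_def_field, zero_smul, one_smul, add_zero, add_sub_cancel, sub_zero,
    div_one] at h
  linarith

/-- Convex functions with Lipschitz gradient: the Bregman distance bounds the squared distance of
gradients. -/
theorem norm_gradient_sub_sq_le {f : E → ℝ} (hf : Differentiable ℝ f) {L : ℝ≥0}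
    (hL : LipschitzWith L (gradient f)) (hc : ConvexOn ℝ Set.univ f) (x y : E) :
    ‖gradient f y - gradient f x‖ ^ 2 ≤
      2 * L * (f y - f x - inner ℝ (gradient f x) (y - x)) := by
  rcases eq_or_lt_of_le (zero_le (a := L)) with h0 | hpos
  · subst h0
    have := hL.norm_sub_le y x
    simp only [NNReal.coe_zero, zero_mul, norm_le_zero_iff] at this
    simp [this]
  · have hpos' : (0 : ℝ) < L := hpos
    set g := gradient f y - gradient f x with hg
    -- The point `y - g / L` is reached from `y` by the descent lemma and from `x` by convexity; the
    -- two bounds are combined.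
    have h1 := sub_le_of_lipschitz_gradient hf hL y (y - (1 / (L : ℝ)) • g)
    have h2 := gradient_inequality hf hc x (y - (1 / (L : ℝ)) • g)
    have h3 : y - (1 / (L : ℝ)) • g - y = -((1 / (L : ℝ)) • g) := by abel
    have h4 : y - (1 / (L : ℝ)) • g - x = (y - x) - (1 / (L : ℝ)) • g := by abel
    rw [h3, norm_neg, norm_smul, inner_neg_right, inner_smul_right,
      Real.norm_of_nonneg (by positivity)] at h1
    rw [h4, inner_sub_right, inner_smul_right] at h2
    have h5 : inner ℝ (gradient f y) g - inner ℝ (gradient f x) g = ‖g‖ ^ 2 := by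
      rw [← inner_sub_left, ← hg, real_inner_self_eq_norm_sq]
    have h6 : (L : ℝ) / 2 * (1 / L * ‖g‖) ^ 2 = 1 / L * ‖g‖ ^ 2 / 2 := by field_simp
    have h7 : 1 / (L : ℝ) * ‖g‖ ^ 2 / 2 ≤ f y - f x - inner ℝ (gradient f x) (y - x) := by
      rw [h6] at h1
      have h8 : 1 / (L : ℝ) * inner ℝ (gradient f y) g - 1 / L * inner ℝ (gradient f x) g =
        1 / L * ‖g‖ ^ 2 := by rw [← mul_sub, h5]
      linarith
    calc ‖g‖ ^ 2 = 2 * L * (1 / (L : ℝ) * ‖g‖ ^ 2 / 2) := by field_simp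
      _ ≤ _ := by gcongr

/-- Fermat's rule along every line; convexity plays no role. -/
theorem eq_add_smul_gradient_of_isMinOn {f : E → ℝ} (hf : Differentiable ℝ f) {γ : ℝ} (hγ : 0 < γ)
    {u s : E} (hu : ∀ w, f u + 1 / (2 * γ) * ‖u - s‖ ^ 2 ≤ f w + 1 / (2 * γ) * ‖w - s‖ ^ 2) :
    s = u + γ • gradient f u := by
  have key : ∀ d : E, inner ℝ (gradient f u) d + 1 / γ * inner ℝ (u - s) d = 0 := by
    intro d
    have h1 := hasDerivAt_comp_line hf u d 0
    have h2 : HasDerivAt (fun t : ℝ => 1 / (2 * γ) * ‖(u - s) + t • d‖ ^ 2)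
        (1 / γ * inner ℝ (u - s) d) 0 := by
      have h3 : HasDerivAt (fun t : ℝ => (u - s) + t • d) d 0 := by
        simpa using ((hasDerivAt_id (0 : ℝ)).smul_const d).const_add (u - s)
      have h4 := h3.norm_sq.const_mul (1 / (2 * γ))
      refine h4.congr_deriv ?_
      rw [zero_smul, add_zero]
      field_simp
    have h5 := h1.add h2
    simp only [zero_smul, add_zero] at h5
    refine IsLocalMin.hasDerivAt_eq_zero (Eventually.of_forall fun t => ?_) h5
    have := hu (u + t • d)
    simp only [zero_smul, add_zero, Pi.add_apply]
    rwa [show u - s + t • d = u + t • d - s by abel]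
  have h := key (gradient f u + (1 / γ) • (u - s))
  rw [← real_inner_smul_left, ← inner_add_left, inner_self_eq_zero] at h
  have h' : γ • (gradient f u + (1 / γ) • (u - s)) = 0 := by rw [h, smul_zero]
  rw [smul_add, smul_smul, mul_one_div_cancel hγ.ne', one_smul] at h'
  rw [← sub_eq_zero, ← neg_eq_zero, ← h']
  abel

end Smooth

/-! ### The smooth case -/

/-- The algebraic core of the nominal decrease in the smooth case: the change of the envelope is
bounded below by a Bregman distance and two quadratic terms. -/
theorem smooth_envelope_change {γ lam a a' q q' : ℝ} (hγ : 0 < γ) (hlam : 0 < lam)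
    {u v u' v' g g' : E} (hs : u' + γ • g' = u + γ • g - lam • (u - v))
    (hq : q' + 1 / (2 * γ) * ‖v' - ((2 : ℝ) • u' - (u' + γ • g'))‖ ^ 2 ≤
      q + 1 / (2 * γ) * ‖v - ((2 : ℝ) • u' - (u' + γ • g'))‖ ^ 2) :
    γ * (a' + q' + (1 / γ * inner ℝ (γ • g') (v' - u') + 1 / (2 * γ) * ‖v' - u'‖ ^ 2)) +
        (γ * (a - a' - inner ℝ g' (u - u')) +
          (1 / lam - 1 / 2) * ‖u - u'‖ ^ 2 - 1 / lam * ‖γ • (g - g')‖ ^ 2) ≤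
      γ * (a + q + (1 / γ * inner ℝ (γ • g) (v - u) + 1 / (2 * γ) * ‖v - u‖ ^ 2)) := by
  -- In terms of `d`, `z`, `A = γ • g` and `e`, the increment of `γ • g`, with `r = (d + e) / lam`,
  -- everything becomes a polynomial in inner products. The only inequality used is `hq`; the
  -- remaining terms cancel identically.
  obtain ⟨d, rfl⟩ : ∃ d, u' = u - d := ⟨u - u', by abel⟩
  obtain ⟨z, rfl⟩ : ∃ z, v' = u - d + z := ⟨v' - (u - d), by abel⟩
  obtain ⟨e, rfl⟩ : ∃ e, g' = g - (1 / γ) • e :=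
    ⟨γ • (g - g'), by rw [smul_smul, one_div_mul_cancel hγ.ne', one_smul]; abel⟩
  have hγe : ∀ w : E, γ • (g - (1 / γ) • w) = γ • g - w := fun w => by
    rw [smul_sub, smul_smul, mul_one_div_cancel hγ.ne', one_smul]
  obtain ⟨r, rfl⟩ : ∃ r, v = u - r := ⟨u - v, by abel⟩
  have hde : d + e = lam • r := by
    rw [hγe, sub_sub_cancel] at hs
    have : u - d + (γ • g - e) = u + γ • g - (d + e) := by abel
    rw [this] at hs
    exact sub_right_injective hs
  obtain rfl : r = (1 / lam) • (d + e) := by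
    rw [hde, smul_smul, one_div_mul_cancel hlam.ne', one_smul]
  obtain ⟨A, rfl⟩ : ∃ A, g = (1 / γ) • A :=
    ⟨γ • g, by rw [smul_smul, one_div_mul_cancel hγ.ne', one_smul]⟩
  have e1 : u - d + z - ((2 : ℝ) • (u - d) - (u - d + γ • ((1 / γ) • A - (1 / γ) • e))) =
      z + (A - e) := by
    rw [hγe, smul_smul, mul_one_div_cancel hγ.ne']; module
  have e2 : u - (1 / lam) • (d + e) -
      ((2 : ℝ) • (u - d) - (u - d + γ • ((1 / γ) • A - (1 / γ) • e))) =
      (d - (1 / lam) • (d + e)) + (A - e) := by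
    rw [hγe, smul_smul, mul_one_div_cancel hγ.ne']; module
  rw [e1, e2] at hq
  have e3 : u - (1 / lam) • (d + e) - u = -((1 / lam) • (d + e)) := by abel
  have e4 : γ • ((1 / γ) • A - ((1 / γ) • A - (1 / γ) • e)) = e := by
    rw [sub_sub_cancel, smul_smul, mul_one_div_cancel hγ.ne', one_smul]
  have e5 : (1 / γ) • A - (1 / γ) • e = (1 / γ) • (A - e) := by rw [smul_sub]
  rw [e3, e4, e5, smul_smul, smul_smul, mul_one_div_cancel hγ.ne', one_smul, one_smul, norm_neg,
    add_sub_cancel_left, sub_sub_cancel]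
  have hq' : γ * q' + 1 / 2 * ‖z + (A - e)‖ ^ 2 ≤
      γ * q + 1 / 2 * ‖d - (1 / lam) • (d + e) + (A - e)‖ ^ 2 := by
    have := mul_le_mul_of_nonneg_left hq hγ.le
    rw [mul_add, mul_add, ← mul_assoc, ← mul_assoc] at this
    rwa [show γ * (1 / (2 * γ)) = 1 / 2 by field_simp] at this
  have f1 : ∀ x : ℝ, γ * (1 / γ * x) = x := fun x => by field_simp
  have f2 : ∀ x : ℝ, γ * (1 / (2 * γ) * x) = x / 2 := fun x => by field_simp
  simp only [mul_add, mul_sub, f1, f2, real_inner_smul_left, inner_neg_right]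
  rw [norm_add_sq_real z, norm_add_sq_real (d - _), norm_sub_sq_real d] at hq'
  simp only [real_inner_smul_right, inner_sub_left, inner_sub_right, inner_add_left,
    inner_add_right, real_inner_smul_left, norm_smul, mul_pow, norm_add_sq_real,
    real_inner_self_eq_norm_sq] at hq' ⊢
  rw [real_inner_comm z A, real_inner_comm z e, real_inner_comm d e, real_inner_comm d A,
    real_inner_comm e A] at *
  linarith

section SmoothCase

variable [CompleteSpace E] {φ₁ φ₂ : E → EReal} {f : E → ℝ} {L : ℝ≥0} {γ lam c : ℝ}

theorem ne_bot_of_eq_coe (hφ : ∀ x, φ₁ x = (f x : EReal)) (x : E) : φ₁ x ≠ ⊥ := by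
  rw [hφ]; exact EReal.coe_ne_bot _

theorem convexOn_of_isConvexFun (hφ : ∀ x, φ₁ x = (f x : EReal)) (hc : IsConvexFun φ₁) :
    ConvexOn ℝ Set.univ f := by
  refine convexOn_iff_forall_pos.2 ⟨convex_univ, fun x _ y _ a b ha hb hab => ?_⟩
  have h := hc x y a b ha hb hab
  rw [hφ, hφ, hφ] at h
  exact_mod_cast h

theorem mem_prox_iff_of_eq_coe (hφ : ∀ x, φ₁ x = (f x : EReal)) {u s : E} :
    u ∈ prox γ φ₁ s ↔
      ∀ w, f u + 1 / (2 * γ) * ‖u - s‖ ^ 2 ≤ f w + 1 / (2 * γ) * ‖w - s‖ ^ 2 := by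
  rw [mem_prox_iff (ne_bot_of_eq_coe hφ)]
  simp only [hφ, EReal.toReal_coe, mem_dom_of_eq_coe (hφ _), true_and, true_implies]

theorem eq_add_smul_gradient_of_mem_prox (hφ : ∀ x, φ₁ x = (f x : EReal))
    (hf : Differentiable ℝ f) (hγ : 0 < γ) {u s : E} (hu : u ∈ prox γ φ₁ s) :
    s = u + γ • gradient f u :=
  eq_add_smul_gradient_of_isMinOn hf hγ ((mem_prox_iff_of_eq_coe hφ).1 hu)

/-- Two proximal points differ by `γ` times a difference of gradients, a strict contraction when `γL
< 1`. -/
theorem eq_of_mem_prox (hφ : ∀ x, φ₁ x = (f x : EReal)) (hf : Differentiable ℝ f)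
    (hL : LipschitzWith L (gradient f)) (hγ : 0 < γ) (hγL : γ * L < 1) {u w s : E}
    (hu : u ∈ prox γ φ₁ s) (hw : w ∈ prox γ φ₁ s) : w = u := by
  have h1 := eq_add_smul_gradient_of_mem_prox hφ hf hγ hu
  have h2 := eq_add_smul_gradient_of_mem_prox hφ hf hγ hw
  have h3 : w - u = γ • (gradient f u - gradient f w) := by
    rw [smul_sub, sub_eq_sub_iff_add_eq_add, ← h2, add_comm, ← h1]
  have h4 : ‖w - u‖ ≤ γ * L * ‖w - u‖ := by
    calc ‖w - u‖ = γ * ‖gradient f u - gradient f w‖ := by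
          rw [h3, norm_smul, Real.norm_of_nonneg hγ.le]
      _ ≤ γ * (L * ‖u - w‖) := mul_le_mul_of_nonneg_left (hL.norm_sub_le _ _) hγ.le
      _ = γ * L * ‖w - u‖ := by rw [norm_sub_rev]; ring
  have h5 : ‖w - u‖ = 0 := by nlinarith [norm_nonneg (w - u)]
  exact sub_eq_zero.1 (norm_eq_zero.1 h5)

theorem dreReal_of_smooth (hφ : ∀ x, φ₁ x = (f x : EReal)) {u v : E} :
    dreReal φ₁ φ₂ γ (u + γ • gradient f u) u v = f u + (φ₂ v).toReal +
      (1 / γ * inner ℝ (γ • gradient f u) (v - u) + 1 / (2 * γ) * ‖v - u‖ ^ 2) := by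
  rw [dreReal, hφ, EReal.toReal_coe, add_sub_cancel_left]

/-- Since `L ≤ 1 / γ`, the quadratic model of `f` inside the envelope is an upper bound for `f v`.
-/
theorem le_dreReal_of_smooth (hφ : ∀ x, φ₁ x = (f x : EReal)) (hf : Differentiable ℝ f)
    (hL : LipschitzWith L (gradient f)) (hγ : 0 < γ) (hγL : γ * L < 1) {s u v : E}
    (hu : u ∈ prox γ φ₁ s) :
    f v + (φ₂ v).toReal ≤ dreReal φ₁ φ₂ γ s u v := by
  rw [eq_add_smul_gradient_of_mem_prox hφ hf hγ hu, dreReal_of_smooth hφ, real_inner_smul_left]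
  have h1 := sub_le_of_lipschitz_gradient hf hL u v
  have h2 : (L : ℝ) / 2 ≤ 1 / (2 * γ) := by
    rw [div_le_div_iff₀ two_pos (by positivity)]; linarith
  have h3 := mul_le_mul_of_nonneg_right h2 (sq_nonneg ‖v - u‖)
  have h4 : 1 / γ * (γ * inner ℝ (gradient f u) (v - u)) = inner ℝ (gradient f u) (v - u) := by
    field_simp
  linarith

/-- Nominal steps decrease the envelope in the smooth case. -/
theorem nominal_decrease_of_smooth (hφ : ∀ x, φ₁ x = (f x : EReal)) (hb₂ : ∀ x, φ₂ x ≠ ⊥)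
    (hf : Differentiable ℝ f) (hL : LipschitzWith L (gradient f)) (hγ : 0 < γ) (hlam : 0 < lam)
    (hc : 0 < c) (hcC : c < decreaseConst (IsConvexFun φ₁) (γ * L) lam) {s u v u' v' : E}
    (h : (u, v) ∈ drs φ₁ φ₂ γ s) (h' : (u', v') ∈ drs φ₁ φ₂ γ (nominal lam s u v)) :
    dreReal φ₁ φ₂ γ (nominal lam s u v) u' v' ≤
      dreReal φ₁ φ₂ γ s u v - c / γ * ‖u - v‖ ^ 2 := by
  have hv := (mem_prox_iff hb₂).1 h.2
  have hv' := (mem_prox_iff hb₂).1 h'.2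
  have hs := eq_add_smul_gradient_of_mem_prox hφ hf hγ h.1
  have hs' := eq_add_smul_gradient_of_mem_prox hφ hf hγ h'.1
  have hstep : u' + γ • gradient f u' = u + γ • gradient f u - lam • (u - v) := by
    rw [← hs', ← hs, nominal]
  have hq := hv'.2 v hv.1
  simp only at hq
  rw [hs'] at hq ⊢
  rw [hs, dreReal_of_smooth hφ, dreReal_of_smooth hφ]
  have key := smooth_envelope_change (a := f u) (a' := f u') hγ hlam hstep hq
  have hr : lam • (u - v) = γ • (gradient f u - gradient f u') + (u - u') := by
    have : lam • (u - v) = u + γ • gradient f u - (u' + γ • gradient f u') := by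
      rw [hstep, sub_sub_cancel]
    rw [this, smul_sub]; abel
  have hγL : 0 ≤ γ * L := by positivity
  have hgrad : ‖γ • (gradient f u - gradient f u')‖ ≤ γ * L * ‖u - u'‖ := by
    rw [norm_smul, Real.norm_of_nonneg hγ.le, mul_assoc]
    exact mul_le_mul_of_nonneg_left (hL.norm_sub_le _ _) hγ.le
  have hgrad2 : ‖γ • (gradient f u - gradient f u')‖ ^ 2 ≤ (γ * L) ^ 2 * ‖u - u'‖ ^ 2 := by
    rw [← mul_pow]; exact pow_le_pow_left₀ (norm_nonneg _) hgrad 2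
  have hcr := decrease_le_of_norm_le hlam hγL hc hcC hr hgrad
  have hfin : c * ‖u - v‖ ^ 2 ≤ γ * (f u - f u' - inner ℝ (gradient f u') (u - u')) +
      (1 / lam - 1 / 2) * ‖u - u'‖ ^ 2 -
        1 / lam * ‖γ • (gradient f u - gradient f u')‖ ^ 2 := by
    refine hcr.trans ?_
    by_cases hcvx : IsConvexFun φ₁
    · rw [if_pos hcvx]
      have hco := convexOn_of_isConvexFun hφ hcvx
      have hD := norm_gradient_sub_sq_le hf hL hco u' u
      have hD0 := gradient_inequality hf hco u' u
      set D := f u - f u' - inner ℝ (gradient f u') (u - u')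
      have hD0' : 0 ≤ D := by linarith
      have hge : ‖γ • (gradient f u - gradient f u')‖ ^ 2 ≤ γ * L * (2 * (γ * D)) := by
        rw [norm_smul, mul_pow, Real.norm_of_nonneg hγ.le]
        nlinarith [mul_le_mul_of_nonneg_left hD (sq_nonneg γ)]
      set N := ‖γ • (gradient f u - gradient f u')‖ ^ 2
      set α := γ * L
      set M := ‖u - u'‖ ^ 2
      have hM : 0 ≤ M := sq_nonneg _
      have hN : 0 ≤ N := sq_nonneg _
      have hX : 0 ≤ γ * D := by positivity
      suffices H : N - α * max (α - lam / 2) 0 * M ≤ lam * (γ * D) by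
        have e : (1 / lam - 1 / 2) * M - 1 / lam * N + γ * D -
            ((2 - lam) / 2 - α * max (α - lam / 2) 0) / lam * M =
            1 / lam * (lam * (γ * D) - (N - α * max (α - lam / 2) 0 * M)) := by
          field_simp; ring
        have := mul_nonneg (one_div_pos.2 hlam).le (sub_nonneg.2 H)
        linarith
      -- If `α ≤ lam / 2`, cocoercivity `N ≤ 2α(γD)` suffices. Otherwise `N` is split with weights
      -- `α - lam / 2` and `lam / 2`: the first part uses the Lipschitz bound, the second
      -- cocoercivity, and the total is divided by `α`.
      rcases le_total (α - lam / 2) 0 with hle | hle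
      · rw [max_eq_right hle]
        nlinarith [mul_nonneg (sub_nonneg.2 hle) hX]
      · rw [max_eq_left hle]
        rcases eq_or_lt_of_le hγL with h0 | h0
        · rw [← h0] at hge ⊢
          nlinarith [mul_nonneg hlam.le hX]
        · have h1 := mul_le_mul_of_nonneg_left hgrad2 hle
          have h2 := mul_le_mul_of_nonneg_left hge hlam.le
          refine le_of_mul_le_mul_left ?_ h0
          nlinarith
    · rw [if_neg hcvx]
      have hD := sub_ge_of_lipschitz_gradient hf hL u' u
      have hD' : -(γ * L / 2 * ‖u - u'‖ ^ 2) ≤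
          γ * (f u - f u' - inner ℝ (gradient f u') (u - u')) := by
        have := mul_le_mul_of_nonneg_left
          (show -(L / 2 * ‖u - u'‖ ^ 2) ≤ f u - f u' - inner ℝ (gradient f u') (u - u') by
            linarith) hγ.le
        linarith
      have hB : 0 ≤ ((2 - lam) / 2 - γ * L * 1) / lam := by
        have h1 : 0 < decreaseConst (IsConvexFun φ₁) (γ * L) lam := hc.trans hcC
        rw [decreaseConst, if_neg hcvx] at h1
        have := pos_of_mul_pos_right h1 (by positivity)
        positivity
      -- The available coefficient factors as `1 + α` times the needed one, which is nonnegative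
      -- because `0 < c`; the surplus is dropped.
      have e : (1 / lam - 1 / 2) * ‖u - u'‖ ^ 2 - 1 / lam * ((γ * L) ^ 2 * ‖u - u'‖ ^ 2) -
          γ * L / 2 * ‖u - u'‖ ^ 2 =
          (1 + γ * L) * (((2 - lam) / 2 - γ * L * 1) / lam * ‖u - u'‖ ^ 2) := by
        field_simp; ring
      have h1 := mul_le_mul_of_nonneg_left hgrad2 (one_div_pos.2 hlam).le
      have h2 : 0 ≤ γ * L * (((2 - lam) / 2 - γ * L * 1) / lam * ‖u - u'‖ ^ 2) := by positivity
      linarith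
  refine le_of_mul_le_mul_left ?_ hγ
  rw [mul_sub, ← mul_assoc, mul_div_cancel₀ _ hγ.ne']
  linarith

end SmoothCase

/-! ### Semicontinuity and subdifferentials -/

/-- Lower semicontinuity in terms of real upper bounds along a sequence. -/
theorem le_of_tendsto_of_lsc {X : Type*} [TopologicalSpace X] {h : X → EReal}
    (hl : LowerSemicontinuous h) {x : ℕ → X} {a : X}
    (hx : Tendsto x atTop (𝓝 a)) {r : ℕ → ℝ} {l : ℝ} (hr : Tendsto r atTop (𝓝 l))
    (hle : ∀ k, h (x k) ≤ (r k : EReal)) : h a ≤ (l : EReal) := by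
  by_contra! hlt
  obtain ⟨b, hlb, hb⟩ := EReal.lt_iff_exists_real_btwn.1 hlt
  have h1 := hx.eventually (hl a b hb)
  have h2 := hr.eventually (gt_mem_nhds (EReal.coe_lt_coe_iff.1 hlb))
  obtain ⟨k, hk1, hk2⟩ := (h1.and h2).exists
  exact absurd (hk1.trans_le (hle k)) (not_lt.2 (EReal.coe_le_coe_iff.2 hk2.le))

/-- A quadratic minorant that touches `h` at `x` makes `x` stationary. -/
theorem isStationary_of_quadratic_minorant {h : E → EReal} {x : E} {a K : ℝ} (hx : h x = (a : EReal))
    (hmin : ∀ y, ((a - K * ‖y - x‖ ^ 2 : ℝ) : EReal) ≤ h y) : IsStationary h x := by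
  have hd : x ∈ dom h := mem_dom_of_eq_coe hx
  refine ⟨hd, fun _ => x, fun _ => 0, fun _ => ⟨hd, ?_⟩, tendsto_const_nhds, tendsto_const_nhds,
    tendsto_const_nhds⟩
  have hlim : Tendsto (fun y => ((-(K * ‖y - x‖) : ℝ) : EReal)) (𝓝[≠] x) (𝓝 0) := by
    have h1 : Continuous fun y => -(K * ‖y - x‖) := by fun_prop
    have h2 := (continuous_coe_real_ereal.comp h1).tendsto x
    simp only [Function.comp_def, sub_self, norm_zero, mul_zero, neg_zero, EReal.coe_zero] at h2
    exact h2.mono_left nhdsWithin_le_nhds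
  -- In dimension zero the punctured neighbourhood filter is trivial and the liminf is `⊤`.
  rcases (𝓝[≠] x).eq_or_neBot with hbot | hne
  · rw [hbot, liminf_bot]; exact le_top
  rw [← hlim.liminf_eq]
  refine liminf_le_liminf ?_
  filter_upwards [self_mem_nhdsWithin] with y hy
  have hpos : 0 < ‖y - x‖ := norm_pos_iff.2 (sub_ne_zero.2 hy)
  rw [EReal.le_div_iff_mul_le (EReal.coe_pos.2 hpos) (EReal.coe_ne_top _), inner_zero_left,
    EReal.coe_zero, sub_zero, hx]
  refine le_trans (le_of_eq ?_) (EReal.sub_le_sub (hmin y) le_rfl)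
  rw [← EReal.coe_mul, ← EReal.coe_sub]
  congr 1
  ring

section SmoothCase

variable [CompleteSpace E] {φ₁ φ₂ : E → EReal} {f : E → ℝ} {L : ℝ≥0} {γ lam c : ℝ}

/-- Completing the square, the prox objective at `2u - s` and the envelope, as functions of the
second point, differ by a constant. In particular the envelope value does not depend on the choice
of `v`. -/
theorem dreReal_le_of_mem_prox (hb₂ : ∀ x, φ₂ x ≠ ⊥) (hγ : 0 < γ) {s u v w : E}
    (hv : v ∈ prox γ φ₂ ((2 : ℝ) • u - s)) (hw : w ∈ dom φ₂) :
    dreReal φ₁ φ₂ γ s u v ≤ dreReal φ₁ φ₂ γ s u w := by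
  have h := ((mem_prox_iff hb₂).1 hv).2 w hw
  have e : ∀ z : E, 1 / (2 * γ) * ‖z - ((2 : ℝ) • u - s)‖ ^ 2 =
      1 / γ * inner ℝ (s - u) (z - u) + 1 / (2 * γ) * ‖z - u‖ ^ 2 +
        1 / (2 * γ) * ‖s - u‖ ^ 2 := by
    intro z
    rw [show z - ((2 : ℝ) • u - s) = (s - u) + (z - u) by module, norm_add_sq_real]
    field_simp
    ring
  rw [e, e] at h
  unfold dreReal
  linarith

/-- Minimality of `x` in the envelope and the lower descent bound for `f` combine into a quadratic
minorant of the cost touching at `x`. -/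
theorem isStationary_of_mem_prox (hφ : ∀ x, φ₁ x = (f x : EReal)) (hb₂ : ∀ x, φ₂ x ≠ ⊥)
    (hf : Differentiable ℝ f) (hL : LipschitzWith L (gradient f)) (hγ : 0 < γ) {x : E}
    (hx : x ∈ prox γ φ₂ ((2 : ℝ) • x - (x + γ • gradient f x))) : IsStationary (φ₁ + φ₂) x := by
  have hd := ((mem_prox_iff hb₂).1 hx).1
  have hb₁ := ne_bot_of_eq_coe hφ
  refine isStationary_of_quadratic_minorant (K := 1 / (2 * γ) + L / 2)
    (toReal_add_of_mem_dom hb₁ hb₂ (mem_dom_of_eq_coe (hφ x)) hd) fun y => ?_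
  by_cases hy : y ∈ dom φ₂
  · rw [toReal_add_of_mem_dom hb₁ hb₂ (mem_dom_of_eq_coe (hφ y)) hy, EReal.coe_le_coe_iff, hφ, hφ,
      EReal.toReal_coe, EReal.toReal_coe]
    have h := dreReal_le_of_mem_prox (φ₁ := φ₁) hb₂ hγ hx hy
    rw [dreReal_of_smooth hφ, dreReal_of_smooth hφ, sub_self, inner_zero_right, norm_zero,
      real_inner_smul_left, ← mul_assoc, one_div_mul_cancel hγ.ne'] at h
    have h2 := sub_ge_of_lipschitz_gradient hf hL x y
    linarith
  · have : (φ₁ + φ₂) y = ⊤ := by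
      by_contra hne
      exact hy ((mem_dom_add hb₁ hb₂).1 (mem_dom_iff.2 hne)).2
    rw [this]; exact le_top

theorem StepsizeCond.mul_lt_one (hstep : StepsizeCond φ₁ L γ lam) (hlam : 0 < lam) :
    γ * L < 1 := by
  by_cases h : IsConvexFun φ₁
  · exact hstep.1 h
  · have := hstep.2 h
    linarith

/-- Limits along subsequences of fixed-point residuals tending to zero. -/
theorem limit_of_subsequence (hφ : ∀ x, φ₁ x = (f x : EReal)) (hb₂ : ∀ x, φ₂ x ≠ ⊥)
    (hlsc : LowerSemicontinuous φ₂)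
    (hf : Differentiable ℝ f) (hL : LipschitzWith L (gradient f)) (hγ : 0 < γ) {s u v : ℕ → E}
    (hmem : ∀ k, (u k, v k) ∈ drs φ₁ φ₂ γ (s k)) {x : E} {l : ℝ}
    (hu : Tendsto u atTop (𝓝 x)) (hv : Tendsto v atTop (𝓝 x))
    (hD : Tendsto (fun k => dreReal φ₁ φ₂ γ (s k) (u k) (v k)) atTop (𝓝 l)) :
    Tendsto s atTop (𝓝 (x + γ • gradient f x)) ∧
      (x, x) ∈ drs φ₁ φ₂ γ (x + γ • gradient f x) ∧ f x + (φ₂ x).toReal = l := by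
  have hb₁ := ne_bot_of_eq_coe hφ
  have hs' : ∀ k, s k = u k + γ • gradient f (u k) := fun k =>
    eq_add_smul_gradient_of_mem_prox hφ hf hγ (hmem k).1
  have hsx : Tendsto s atTop (𝓝 (x + γ • gradient f x)) := by
    rw [show s = fun k => u k + γ • gradient f (u k) from funext hs']
    exact hu.add (((hL.continuous.tendsto x).comp hu).const_smul γ)
  set σ := x + γ • gradient f x
  have hfu : Tendsto (fun k => f (u k)) atTop (𝓝 (f x)) := (hf.continuous.tendsto x).comp hu
  -- the part of the envelope other than `φ₂ v`
  have hrest : ∀ w : ℕ → E, ∀ w' : E, Tendsto w atTop (𝓝 w') → Tendsto (fun k => f (u k) +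
      (1 / γ * inner ℝ (s k - u k) (w k - u k) + 1 / (2 * γ) * ‖w k - u k‖ ^ 2)) atTop
      (𝓝 (f x + (1 / γ * inner ℝ (σ - x) (w' - x) + 1 / (2 * γ) * ‖w' - x‖ ^ 2))) := by
    intro w w' hw
    exact hfu.add ((((hsx.sub hu).inner (hw.sub hu)).const_mul _).add
      (((hw.sub hu).norm.pow 2).const_mul _))
  have hvdom := fun k => (dom_of_mem_drs hb₁ hb₂ (hmem k)).2
  -- All other terms of the envelope are continuous, so convergence of the envelope forces that of
  -- `φ₂ (v k)`.
  have hφ₂v : Tendsto (fun k => (φ₂ (v k)).toReal) atTop (𝓝 (l - f x)) := by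
    have h1 := hD.sub (hrest v x hv)
    rw [sub_self, inner_zero_right, norm_zero] at h1
    have h2 : l - (f x + (1 / γ * 0 + 1 / (2 * γ) * 0 ^ 2)) = l - f x := by ring
    rw [h2] at h1
    refine h1.congr fun k => ?_
    rw [dreReal, hφ, EReal.toReal_coe]
    ring
  have hle : φ₂ x ≤ ((l - f x : ℝ) : EReal) :=
    le_of_tendsto_of_lsc hlsc hv hφ₂v fun k => (coe_toReal_of_mem_dom hb₂ (hvdom k)).ge
  have hxd : x ∈ dom φ₂ := mem_dom_iff.2 (ne_top_of_le_ne_top (EReal.coe_ne_top _) hle)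
  have hbound : ∀ w ∈ dom φ₂, l ≤ dreReal φ₁ φ₂ γ σ x w := by
    intro w hw
    have h1 := (hrest (fun _ => w) w tendsto_const_nhds).add_const (φ₂ w).toReal
    have h2 := le_of_tendsto_of_tendsto' hD h1 fun k => by
      have := dreReal_le_of_mem_prox (φ₁ := φ₁) hb₂ hγ (hmem k).2 hw
      refine this.trans (le_of_eq ?_)
      rw [dreReal, hφ, EReal.toReal_coe]
      ring
    refine h2.trans (le_of_eq ?_)
    rw [dreReal, hφ, EReal.toReal_coe]
    ring
  have hxx : dreReal φ₁ φ₂ γ σ x x = f x + (φ₂ x).toReal := by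
    rw [dreReal, hφ, EReal.toReal_coe]; simp
  -- Lower semicontinuity gives one inequality, the limiting minimality tested at `x` itself the
  -- other.
  have heq : f x + (φ₂ x).toReal = l := by
    refine le_antisymm ?_ (hxx ▸ hbound x hxd)
    rw [← coe_toReal_of_mem_dom hb₂ hxd, EReal.coe_le_coe_iff] at hle
    linarith
  refine ⟨hsx, ⟨?_, ?_⟩, heq⟩
  · rw [mem_prox_iff_of_eq_coe hφ]
    intro w
    refine le_of_tendsto_of_tendsto' (hfu.add (((hu.sub hsx).norm.pow 2).const_mul (1 / (2 * γ))))
      ((((tendsto_const_nhds (x := w)).sub hsx).norm.pow 2).const_mul (1 / (2 * γ))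
        |>.const_add (f w)) fun k => ?_
    exact (mem_prox_iff_of_eq_coe hφ).1 (hmem k).1 w
  · rw [mem_prox_iff hb₂]
    refine ⟨hxd, fun w hw => ?_⟩
    have h := hbound w hw
    rw [← heq, ← hxx] at h
    have e : ∀ z : E, 1 / (2 * γ) * ‖z - ((2 : ℝ) • x - σ)‖ ^ 2 =
        1 / γ * inner ℝ (σ - x) (z - x) + 1 / (2 * γ) * ‖z - x‖ ^ 2 +
          1 / (2 * γ) * ‖σ - x‖ ^ 2 := by
      intro z
      rw [show z - ((2 : ℝ) • x - σ) = (σ - x) + (z - x) by module, norm_add_sq_real]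
      field_simp
      ring
    unfold dreReal at h
    simp only [e]
    linarith

/-- Convergence of linesearch DRS in the smooth case. -/
theorem smooth_convergence [ProperSpace E] {imax : ℕ∞} {s u v : ℕ → E} (hγ : 0 < γ)
    (hlam : 0 < lam) (hc : 0 < c) (hS : SmoothCase φ₁ φ₂ L) (hstep : StepsizeCond φ₁ L γ lam)
    (hcC : c < decreaseConst (IsConvexFun φ₁) (γ * L) lam)
    (hrun : IsRun φ₁ φ₂ 1 γ lam c 0 imax s u v) :
    Summable (fun k => ‖u k - v k‖ ^ 2) ∧
    (∃ φlim : ℝ,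
      Antitone (fun k => dre φ₁ φ₂ γ (s k) (u k) (v k)) ∧
      Tendsto (fun k => dre φ₁ φ₂ γ (s k) (u k) (v k)) atTop (𝓝 (φlim : EReal)) ∧
      (∀ x, MapClusterPt x atTop u ↔ MapClusterPt x atTop v) ∧
      (∀ x, MapClusterPt x atTop u →
        IsStationary (φ₁ + φ₂) x ∧ (φ₁ + φ₂) x = (φlim : EReal) ∧
        ∃ sbar, MapClusterPt sbar atTop s ∧ prox γ φ₁ sbar = {x} ∧
          (x, x) ∈ drs φ₁ φ₂ γ sbar ∧
          ∀ w ∈ drs φ₁ φ₂ γ sbar, dre φ₁ φ₂ γ sbar w.1 w.2 = (φlim : EReal))) ∧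
    (LevelBounded (φ₁ + φ₂) →
      Bornology.IsBounded (Set.range s) ∧ Bornology.IsBounded (Set.range u) ∧
      Bornology.IsBounded (Set.range v)) := by
  obtain ⟨f, hφ, hf, hL⟩ := hS.smooth
  have hb₁ := ne_bot_of_eq_coe hφ
  have hb₂ := hS.ne_bot
  have hγL := hstep.mul_lt_one hlam
  have hmem := hrun.mem_drs
  have hdec := hrun.decrease hb₁ hb₂ hγ fun s u v u' v' h h' => by
    rw [one_mul, one_mul]
    exact nominal_decrease_of_smooth hφ hb₂ hf hL hγ hlam hc hcC h h'
  simp only [one_mul] at hdec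
  have hvdom := fun k => (dom_of_mem_drs hb₁ hb₂ (hmem k)).2
  have hge : ∀ k, f (v k) + (φ₂ (v k)).toReal ≤ dreReal φ₁ φ₂ γ (s k) (u k) (v k) := fun k =>
    le_dreReal_of_smooth hφ hf hL hγ hγL (hmem k).1
  have hsum : ∀ k, (φ₁ + φ₂) (v k) = ((f (v k) + (φ₂ (v k)).toReal : ℝ) : EReal) := fun k => by
    rw [toReal_add_of_mem_dom hb₁ hb₂ (mem_dom_of_eq_coe (hφ _)) (hvdom k), hφ, EReal.toReal_coe]
  obtain ⟨z, hz⟩ := hS.solution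
  have hlow : ∀ k, ((φ₁ + φ₂) z).toReal ≤ dreReal φ₁ φ₂ γ (s k) (u k) (v k) := fun k => by
    refine le_trans ?_ (hge k)
    have := ((mem_argmin_iff (add_ne_bot hb₁ hb₂)).1 hz).2 (v k) (mem_dom_of_eq_coe (hsum k))
    rwa [hsum k, EReal.toReal_coe] at this
  obtain ⟨hsq, hanti, l, hl⟩ := summable_and_antitone_of_decrease (div_pos hc hγ)
    (fun k => sq_nonneg _) hlow hdec
  have hr : Tendsto (fun k => u k - v k) atTop (𝓝 0) := tendsto_of_summable_norm_sq hsq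
  have hdre : (fun k => dre φ₁ φ₂ γ (s k) (u k) (v k)) =
      fun k => (dreReal φ₁ φ₂ γ (s k) (u k) (v k) : EReal) :=
    funext fun k => dre_eq_coe_of_mem_drs hb₁ hb₂ (hmem k)
  have hcl : ∀ (a b : ℕ → E) (x : E), Tendsto (fun k => a k - b k) atTop (𝓝 0) →
      MapClusterPt x atTop a → MapClusterPt x atTop b := by
    intro a b x hab hx
    obtain ⟨ψ, hψ, hψx⟩ := hx.tendsto_subseq
    have h := hψx.sub (hab.comp hψ.tendsto_atTop)
    simp only [Function.comp_def, sub_sub_cancel, sub_zero] at h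
    exact h.mapClusterPt.of_comp hψ.tendsto_atTop
  have hr' : Tendsto (fun k => v k - u k) atTop (𝓝 0) := by simpa using hr.neg
  refine ⟨hsq, ⟨l, ?_, ?_, fun x => ⟨hcl u v x hr, hcl v u x hr'⟩, fun x hx => ?_⟩, fun hlev => ?_⟩
  · rw [hdre]; exact fun i j hij => EReal.coe_le_coe_iff.2 (hanti hij)
  · rw [hdre]; exact (continuous_coe_real_ereal.tendsto l).comp hl
  · obtain ⟨ψ, hψ, hψx⟩ := hx.tendsto_subseq
    have hψv := hψx.sub (hr.comp hψ.tendsto_atTop)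
    simp only [Function.comp_def, sub_sub_cancel, sub_zero] at hψv
    obtain ⟨h1, h2, h3⟩ := limit_of_subsequence hφ hb₂ hS.lsc hf hL hγ
      (fun k => hmem (ψ k)) hψx hψv (hl.comp hψ.tendsto_atTop)
    have hxd := (dom_of_mem_drs hb₁ hb₂ h2).2
    refine ⟨isStationary_of_mem_prox hφ hb₂ hf hL hγ h2.2, ?_, x + γ • gradient f x,
      h1.mapClusterPt.of_comp hψ.tendsto_atTop, ?_, h2, ?_⟩
    · rw [toReal_add_of_mem_dom hb₁ hb₂ (mem_dom_of_eq_coe (hφ _)) hxd, hφ, EReal.toReal_coe, h3]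
    · exact Set.eq_singleton_iff_unique_mem.2
        ⟨h2.1, fun w hw => eq_of_mem_prox hφ hf hL hγ hγL h2.1 hw⟩
    · rintro ⟨w₁, w₂⟩ hw
      obtain rfl : w₁ = x := eq_of_mem_prox hφ hf hL hγ hγL h2.1 hw.1
      rw [dre_eq_coe_of_mem_drs hb₁ hb₂ hw]
      congr 1
      have h4 := dreReal_le_of_mem_prox (φ₁ := φ₁) hb₂ hγ hw.2 hxd
      have h5 := dreReal_le_of_mem_prox (φ₁ := φ₁) hb₂ hγ h2.2 (dom_of_mem_drs hb₁ hb₂ hw).2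
      refine (le_antisymm h4 h5).trans ?_
      rw [dreReal, hφ, EReal.toReal_coe, ← h3]
      simp
  -- The cost at `v k` is at most the initial envelope value; then `u` follows from the vanishing
  -- residual and `s` from the Lipschitz gradient.
  · have hvb : Bornology.IsBounded (Set.range v) := by
      refine (hlev (dreReal φ₁ φ₂ γ (s 0) (u 0) (v 0))).subset ?_
      rintro _ ⟨k, rfl⟩
      change (φ₁ + φ₂) (v k) ≤ _
      rw [hsum, EReal.coe_le_coe_iff]
      exact (hge k).trans (hanti (Nat.zero_le k))
    have hub : Bornology.IsBounded (Set.range u) :=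
      isBounded_range_add hvb (Metric.isBounded_range_of_tendsto _ hr) fun k => by abel
    refine ⟨isBounded_range_add hub ?_ fun k =>
      eq_add_smul_gradient_of_mem_prox hφ hf hγ (hmem k).1, hub, hvb⟩
    have := (hL.isBounded_image hub).smul₀ γ
    refine this.subset ?_
    rintro _ ⟨k, rfl⟩
    exact Set.smul_mem_smul_set ⟨_, ⟨k, rfl⟩, rfl⟩

end SmoothCase

/-! ### Strongly convex functions -/

theorem IsConvexFun.isStronglyConvexFun_zero {h : E → EReal} (hc : IsConvexFun h) :
    IsStronglyConvexFun 0 h := by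
  unfold IsStronglyConvexFun
  simpa using hc

theorem IsStronglyConvexFun.combination_le {h : E → EReal} (hb : ∀ x, h x ≠ ⊥) {μ : ℝ}
    (hs : IsStronglyConvexFun μ h) {x y : E} (hx : x ∈ dom h) (hy : y ∈ dom h) {a b : ℝ}
    (ha : 0 < a) (hb' : 0 < b) (hab : a + b = 1) :
    a • x + b • y ∈ dom h ∧ (h (a • x + b • y)).toReal ≤
      a * (h x).toReal + b * (h y).toReal - μ / 2 * (a * b * ‖x - y‖ ^ 2) := by
  have h1 := hs x y a b ha hb' hab
  simp only at h1
  rw [← coe_toReal_of_mem_dom hb hx, ← coe_toReal_of_mem_dom hb hy] at h1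
  rw [← EReal.coe_sub, ← EReal.coe_sub, ← EReal.coe_mul, ← EReal.coe_mul, ← EReal.coe_add] at h1
  have hd : a • x + b • y ∈ dom h := by
    rw [mem_dom_iff]
    intro htop
    rw [htop, EReal.top_sub_coe] at h1
    exact absurd h1 (not_le.2 (EReal.coe_lt_top _))
  refine ⟨hd, ?_⟩
  rw [← coe_toReal_of_mem_dom hb hd, ← EReal.coe_sub, EReal.coe_le_coe_iff] at h1
  have e : ‖a • x + b • y‖ ^ 2 = a * ‖x‖ ^ 2 + b * ‖y‖ ^ 2 - a * b * ‖x - y‖ ^ 2 := by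
    rw [norm_add_sq_real, norm_sub_sq_real, norm_smul, norm_smul, real_inner_smul_left,
      real_inner_smul_right, Real.norm_of_nonneg ha.le, Real.norm_of_nonneg hb'.le]
    obtain rfl : b = 1 - a := by linarith
    ring
  rw [e] at h1
  linarith

/-- The quadratic minorant of a strongly convex function at a proximal point. -/
theorem prox_minorant {h : E → EReal} (hb : ∀ x, h x ≠ ⊥) {μ γ : ℝ} (hγ : 0 < γ)
    (hs : IsStronglyConvexFun μ h) {s u w : E} (hu : u ∈ prox γ h s) (hw : w ∈ dom h) :
    (h u).toReal + 1 / γ * inner ℝ (s - u) (w - u) + μ / 2 * ‖w - u‖ ^ 2 ≤ (h w).toReal := by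
  obtain ⟨hud, hmin⟩ := (mem_prox_iff hb).1 hu
  set X := (h w).toReal - ((h u).toReal + 1 / γ * inner ℝ (s - u) (w - u) +
    μ / 2 * ‖w - u‖ ^ 2) with hX
  suffices 0 ≤ X by linarith
  -- Minimality of `u` is tested at `u + t • (w - u)` and divided by `t`; the error term vanishes as
  -- `t → 0`.
  have key : ∀ t ∈ Set.Ioo (0 : ℝ) 1,
      0 ≤ X + t * ((1 / (2 * γ) + μ / 2) * ‖w - u‖ ^ 2) := by
    rintro t ⟨ht0, ht1⟩
    obtain ⟨hd, hle⟩ := hs.combination_le hb hud hw (sub_pos.2 ht1) ht0 (sub_add_cancel 1 t)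
    have h1 := hmin _ hd
    have e : (1 - t) • u + t • w - s = t • (w - u) - (s - u) := by module
    rw [e, norm_sub_sq_real (t • _), norm_smul, real_inner_smul_left, Real.norm_of_nonneg ht0.le,
      norm_sub_rev u s, real_inner_comm] at h1
    rw [norm_sub_rev u w] at hle
    have e2 : 1 / (2 * γ) * ((t * ‖w - u‖) ^ 2 - 2 * (t * inner ℝ (s - u) (w - u)) +
        ‖s - u‖ ^ 2) = 1 / (2 * γ) * (t ^ 2 * ‖w - u‖ ^ 2) -
          t * (1 / γ * inner ℝ (s - u) (w - u)) + 1 / (2 * γ) * ‖s - u‖ ^ 2 := by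
      field_simp
    rw [e2] at h1
    refine nonneg_of_mul_nonneg_right (a := t) ?_ ht0
    rw [hX]
    linarith
  have hlim : Tendsto (fun t : ℝ => X + t * ((1 / (2 * γ) + μ / 2) * ‖w - u‖ ^ 2)) (𝓝[>] 0)
      (𝓝 X) := by
    have hcont : Continuous fun t : ℝ => X + t * ((1 / (2 * γ) + μ / 2) * ‖w - u‖ ^ 2) := by
      fun_prop
    have := hcont.tendsto 0
    rw [zero_mul, add_zero] at this
    exact this.mono_left nhdsWithin_le_nhds
  refine ge_of_tendsto hlim ?_
  filter_upwards [Ioo_mem_nhdsGT zero_lt_one] with t ht using key t ht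

/-! ### The strongly convex case -/

/-- The algebraic core of the nominal increase in the strongly convex case. -/
theorem strong_envelope_change {γ lam μ a a' q q' : ℝ} (hγ : 0 < γ) (hlam : 0 < lam)
    {s u v s' u' v' : E} (hs : s' = s - lam • (u - v))
    (h₁ : a + 1 / γ * inner ℝ (s - u) (u' - u) + μ / 2 * ‖u' - u‖ ^ 2 ≤ a')
    (h₂ : q + 1 / γ * inner ℝ ((2 : ℝ) • u - s - v) (v' - v) ≤ q') :
    γ * (a + q + (1 / γ * inner ℝ (s - u) (v - u) + 1 / (2 * γ) * ‖v - u‖ ^ 2)) +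
        ((1 / lam - 1 / 2) * ‖s - u - (s' - u')‖ ^ 2 +
          (μ * γ / 2 - 1 / lam) * ‖u - u'‖ ^ 2) ≤
      γ * (a' + q' + (1 / γ * inner ℝ (s' - u') (v' - u') + 1 / (2 * γ) * ‖v' - u'‖ ^ 2)) := by
  obtain ⟨d, rfl⟩ : ∃ d, u' = u - d := ⟨u - u', by abel⟩
  obtain ⟨z, rfl⟩ : ∃ z, v' = u - d - z := ⟨u - d - v', by abel⟩
  obtain ⟨A, rfl⟩ : ∃ A, s = u + A := ⟨s - u, by abel⟩
  obtain ⟨r, rfl⟩ : ∃ r, v = u - r := ⟨u - v, by abel⟩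
  obtain ⟨e, rfl⟩ : ∃ e, r = (1 / lam) • (d + e) :=
    ⟨lam • r - d, by rw [add_sub_cancel, smul_smul, one_div_mul_cancel hlam.ne', one_smul]⟩
  have hs' : s' = u + A - (d + e) := by
    rw [hs, sub_sub_cancel, smul_smul, mul_one_div_cancel hlam.ne', one_smul]
  subst hs'
  set r := (1 / lam) • (d + e) with hr
  have e1 : (2 : ℝ) • u - (u + A) - (u - r) = r - A := by module
  have e2 : u - d - z - (u - r) = r - d - z := by abel
  have e3 : u + A - (d + e) - (u - d) = A - e := by abel
  have e4 : u - d - z - (u - d) = -z := by abel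
  have e5 : u - d - u = -d := by abel
  have e6 : u - r - u = -r := by abel
  rw [e1, e2] at h₂
  rw [e5, add_sub_cancel_left] at h₁
  rw [e3, e4, e6, add_sub_cancel_left, sub_sub_cancel, sub_sub_cancel]
  simp only [norm_neg, inner_neg_right] at h₁ ⊢
  have g₁ := mul_le_mul_of_nonneg_left h₁ hγ.le
  have g₂ := mul_le_mul_of_nonneg_left h₂ hγ.le
  have f1 : ∀ x : ℝ, γ * (1 / γ * x) = x := fun x => by field_simp
  have f2 : ∀ x : ℝ, γ * (1 / (2 * γ) * x) = x / 2 := fun x => by field_simp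
  simp only [mul_add, f1, f2] at g₁ g₂ ⊢
  -- Half of this square is exactly the slack left after using `h₁` and `h₂`.
  have hsq : 0 ≤ ‖z + ((lam - 1) • r - d)‖ ^ 2 := sq_nonneg _
  have hz : (lam - 1) • r - d = e - r := by
    rw [sub_smul, one_smul, hr, smul_smul, mul_one_div_cancel hlam.ne', one_smul]; abel
  rw [hz, hr] at hsq
  rw [hr] at g₂ ⊢
  rw [norm_add_sq_real z, norm_sub_sq_real e] at hsq
  simp only [real_inner_smul_right, inner_sub_left, inner_sub_right, inner_add_left,
    inner_add_right, real_inner_smul_left, norm_smul, mul_pow, norm_add_sq_real,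
    real_inner_self_eq_norm_sq] at g₁ g₂ hsq ⊢
  rw [Real.norm_of_nonneg (one_div_pos.2 hlam).le] at *
  rw [real_inner_comm d z, real_inner_comm e z, real_inner_comm d e] at *
  have hll : lam * (1 / lam) = 1 := mul_one_div_cancel hlam.ne'
  linarith

section StrongCase

variable {φ₁ φ₂ : E → EReal} {μ γ lam c : ℝ}

theorem prox_minorant_of_convex (hb₂ : ∀ x, φ₂ x ≠ ⊥) (hcvx : IsConvexFun φ₂) (hγ : 0 < γ)
    {s u v w : E} (hv : v ∈ prox γ φ₂ ((2 : ℝ) • u - s)) (hw : w ∈ dom φ₂) :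
    (φ₂ v).toReal + 1 / γ * inner ℝ ((2 : ℝ) • u - s - v) (w - v) ≤ (φ₂ w).toReal := by
  have := prox_minorant hb₂ hγ hcvx.isStronglyConvexFun_zero hv hw
  linarith

/-- Nominal steps increase the envelope in the strongly convex case. -/
theorem nominal_increase_of_strong (hS : StronglyConvexCase φ₁ φ₂ μ) (hγ : 0 < γ)
    (hlam : 0 < lam) (hc : 0 < c) (hcC : c < decreaseConst True (1 / (γ * μ)) lam)
    {s u v u' v' : E} (h : (u, v) ∈ drs φ₁ φ₂ γ s)
    (h' : (u', v') ∈ drs φ₁ φ₂ γ (nominal lam s u v)) :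
    dreReal φ₁ φ₂ γ s u v + c / γ * ‖u - v‖ ^ 2 ≤
      dreReal φ₁ φ₂ γ (nominal lam s u v) u' v' := by
  have hb₁ := hS.proper₁.ne_bot
  have hb₂ := hS.proper₂.ne_bot
  obtain ⟨hud, hvd⟩ := dom_of_mem_drs hb₁ hb₂ h
  obtain ⟨hud', hvd'⟩ := dom_of_mem_drs hb₁ hb₂ h'
  have hμ := hS.pos
  set s' := nominal lam s u v with hs'
  have h₁ := prox_minorant hb₁ hγ hS.strong h.1 hud'
  have h₁' := prox_minorant hb₁ hγ hS.strong h'.1 hud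
  have h₂ := prox_minorant_of_convex hb₂ hS.convex hγ h.2 hvd'
  simp only at h₁ h₁' h₂
  have key := strong_envelope_change hγ hlam hs' h₁ h₂
  set e := s - u - (s' - u') with he
  have hr : lam • (u - v) = (u - u') + e := by rw [he, hs', nominal]; abel
  -- Adding the two prox inequalities for `φ₁` gives strong monotonicity, hence the contraction
  -- factor `1 / (γ * μ)` that replaces `γ * L`.
  have hmono : γ * μ * ‖u - u'‖ ^ 2 ≤ inner ℝ e (u - u') := by
    rw [norm_sub_rev u' u, ← neg_sub u u', inner_neg_right] at h₁
    have h3 : 1 / γ * inner ℝ e (u - u') =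
        1 / γ * inner ℝ (s - u) (u - u') - 1 / γ * inner ℝ (s' - u') (u - u') := by
      rw [he, inner_sub_left]; ring
    have h4 : μ * ‖u - u'‖ ^ 2 ≤ 1 / γ * inner ℝ e (u - u') := by rw [h3]; linarith
    calc γ * μ * ‖u - u'‖ ^ 2 = γ * (μ * ‖u - u'‖ ^ 2) := by ring
      _ ≤ γ * (1 / γ * inner ℝ e (u - u')) := mul_le_mul_of_nonneg_left h4 hγ.le
      _ = _ := by field_simp
  have hα : 0 < 1 / (γ * μ) := by positivity
  have hd : ‖u - u'‖ ≤ 1 / (γ * μ) * ‖e‖ := by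
    rw [one_div, inv_mul_eq_div, le_div_iff₀ (by positivity)]
    rcases eq_or_lt_of_le (norm_nonneg (u - u')) with h0 | h0
    · rw [← h0]; simp
    · refine le_of_mul_le_mul_right ?_ h0
      have := hmono.trans (real_inner_le_norm _ _)
      linarith
  have hcr := decrease_le_of_norm_le hlam hα.le hc hcC hr hd
  rw [if_pos trivial] at hcr
  have hfin : c * ‖u - v‖ ^ 2 ≤ (1 / lam - 1 / 2) * ‖e‖ ^ 2 +
      (μ * γ / 2 - 1 / lam) * ‖u - u'‖ ^ 2 := by
    refine hcr.trans ?_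
    have hd2 : ‖u - u'‖ ^ 2 ≤ (1 / (γ * μ)) ^ 2 * ‖e‖ ^ 2 := by
      rw [← mul_pow]; exact pow_le_pow_left₀ (norm_nonneg _) hd 2
    have hβ : μ * γ = 1 / (1 / (γ * μ)) := by rw [one_div_one_div, mul_comm]
    rw [hβ]
    set α := 1 / (γ * μ)
    have hmax : (α - lam / 2) * ‖u - u'‖ ^ 2 ≤ α * (α * max (α - lam / 2) 0 * ‖e‖ ^ 2) := by
      calc (α - lam / 2) * ‖u - u'‖ ^ 2 ≤ max (α - lam / 2) 0 * ‖u - u'‖ ^ 2 :=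
            mul_le_mul_of_nonneg_right (le_max_left _ _) (sq_nonneg _)
        _ ≤ max (α - lam / 2) 0 * (α ^ 2 * ‖e‖ ^ 2) :=
            mul_le_mul_of_nonneg_left hd2 (le_max_right _ _)
        _ = _ := by ring
    have e1 : (1 / lam - 1 / 2) * ‖e‖ ^ 2 + (1 / α / 2 - 1 / lam) * ‖u - u'‖ ^ 2 -
        ((2 - lam) / 2 - α * max (α - lam / 2) 0) / lam * ‖e‖ ^ 2 =
        1 / (α * lam) * (α * (α * max (α - lam / 2) 0 * ‖e‖ ^ 2) -
          (α - lam / 2) * ‖u - u'‖ ^ 2) := by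
      field_simp; ring
    have := mul_nonneg (by positivity : 0 ≤ 1 / (α * lam)) (sub_nonneg.2 hmax)
    linarith
  refine le_of_mul_le_mul_left ?_ hγ
  rw [mul_add, ← mul_assoc, mul_div_cancel₀ _ hγ.ne']
  unfold dreReal
  linarith

/-- The envelope is a lower bound of the primal cost, with quadratic gap. -/
theorem dreReal_add_le_of_strong (hS : StronglyConvexCase φ₁ φ₂ μ) (hγ : 0 < γ)
    {s u v w : E} (h : (u, v) ∈ drs φ₁ φ₂ γ s) (hw₁ : w ∈ dom φ₁) (hw₂ : w ∈ dom φ₂) :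
    dreReal φ₁ φ₂ γ s u v + (μ / 2 - 1 / (2 * γ)) * ‖w - u‖ ^ 2 ≤
      (φ₁ w).toReal + (φ₂ w).toReal := by
  have h₁ := prox_minorant hS.proper₁.ne_bot hγ hS.strong h.1 hw₁
  have h₂ := prox_minorant_of_convex hS.proper₂.ne_bot hS.convex hγ h.2 hw₂
  simp only at h₁ h₂
  obtain ⟨A, rfl⟩ : ∃ A, s = u + A := ⟨s - u, by abel⟩
  obtain ⟨r, rfl⟩ : ∃ r, v = u - r := ⟨u - v, by abel⟩
  obtain ⟨z, rfl⟩ : ∃ z, w = u + z := ⟨w - u, by abel⟩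
  have e1 : (2 : ℝ) • u - (u + A) - (u - r) = r - A := by module
  have e2 : u + z - (u - r) = z + r := by abel
  have e3 : u - r - u = -r := by abel
  unfold dreReal
  rw [e1, e2] at h₂
  rw [add_sub_cancel_left, add_sub_cancel_left] at h₁
  rw [add_sub_cancel_left, add_sub_cancel_left, e3, inner_neg_right, norm_neg]
  -- The discarded square is the distance from `w` to `v`; discarding it costs the term `-1 / (2γ)`
  -- in the gap.
  have hsq : 0 ≤ 1 / (2 * γ) * ‖r + z‖ ^ 2 := by positivity
  rw [norm_add_sq_real] at hsq
  rw [inner_sub_left, inner_add_right, inner_add_right, real_inner_self_eq_norm_sq] at h₂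
  have e4 : 1 / γ = 2 * (1 / (2 * γ)) := by field_simp
  rw [e4] at h₁ h₂ ⊢
  linarith

/-- An upper bound for the dual variable in directions of `dom φ₁ - dom φ₂`. -/
theorem inner_sub_le_of_strong (hS : StronglyConvexCase φ₁ φ₂ μ) (hγ : 0 < γ)
    {s u v x₁ x₂ : E} (h : (u, v) ∈ drs φ₁ φ₂ γ s) (hx₁ : x₁ ∈ dom φ₁) (hx₂ : x₂ ∈ dom φ₂) :
    inner ℝ (s - u) (x₁ - x₂) ≤ γ * ((φ₁ x₁).toReal + (φ₂ x₂).toReal -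
      dreReal φ₁ φ₂ γ s u v) + ‖u - v‖ ^ 2 / 2 + inner ℝ (u - v) (v - x₂) := by
  have h₁ := prox_minorant hS.proper₁.ne_bot hγ hS.strong h.1 hx₁
  have h₂ := prox_minorant_of_convex hS.proper₂.ne_bot hS.convex hγ h.2 hx₂
  simp only at h₁ h₂
  have hμ : 0 ≤ μ / 2 * ‖x₁ - u‖ ^ 2 := by have := hS.pos; positivity
  have h₃ : (φ₁ u).toReal + 1 / γ * inner ℝ (s - u) (x₁ - u) ≤ (φ₁ x₁).toReal := by linarith
  have g₁ := mul_le_mul_of_nonneg_left h₃ hγ.le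
  have g₂ := mul_le_mul_of_nonneg_left h₂ hγ.le
  have f1 : ∀ x : ℝ, γ * (1 / γ * x) = x := fun x => by field_simp
  have f2 : ∀ x : ℝ, γ * (1 / (2 * γ) * x) = x / 2 := fun x => by field_simp
  unfold dreReal
  simp only [mul_add, mul_sub, f1, f2] at g₁ g₂ ⊢
  obtain ⟨A, rfl⟩ : ∃ A, s = u + A := ⟨s - u, by abel⟩
  obtain ⟨r, rfl⟩ : ∃ r, v = u - r := ⟨u - v, by abel⟩
  have e1 : (2 : ℝ) • u - (u + A) - (u - r) = r - A := by module
  have e3 : u - r - u = -r := by abel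
  rw [e1] at g₂
  rw [add_sub_cancel_left] at g₁
  rw [add_sub_cancel_left, e3, sub_sub_cancel, norm_neg, inner_neg_right]
  simp only [inner_sub_left, inner_sub_right, real_inner_self_eq_norm_sq] at g₁ g₂ ⊢
  linarith

end StrongCase

/-! ### Boundedness in the directions of a set with relative interior point `0` -/

/-- As `0 ∈ D`, the affine span of `D` is its linear span. -/
theorem exists_ball_subset_of_mem_intrinsicInterior {D : Set E}
    (h : (0 : E) ∈ intrinsicInterior ℝ D) :
    ∃ ε > 0, ∀ x ∈ Submodule.span ℝ D, ‖x‖ < ε → x ∈ D := by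
  obtain ⟨y, hy, hy0⟩ := mem_intrinsicInterior.1 h
  obtain ⟨ε, hε, hball⟩ := Metric.mem_nhds_iff.1 (mem_interior_iff_mem_nhds.1 hy)
  have h0 : (0 : E) ∈ D := intrinsicInterior_subset h
  have hspan : ∀ x ∈ Submodule.span ℝ D, x ∈ affineSpan ℝ D := by
    intro x hx
    have hv : x ∈ (affineSpan ℝ D).direction := by
      rw [direction_affineSpan, vectorSpan_eq_span_vsub_set_right ℝ h0]
      simpa using hx
    simpa using AffineSubspace.vadd_mem_of_mem_direction hv (mem_affineSpan ℝ h0)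
  refine ⟨ε, hε, fun x hx hxε => ?_⟩
  have : (⟨x, hspan x hx⟩ : affineSpan ℝ D) ∈ Metric.ball y ε := by
    rw [Metric.mem_ball, Subtype.dist_eq, hy0, dist_zero_right]
    exact hxε
  exact hball this

/-- One-sided bounds at `x` and `-x`, scaled into `D`, are pointwise bounds for the functionals on
the span; Banach–Steinhaus makes them uniform. -/
theorem exists_bound_on_span [FiniteDimensional ℝ E] {ι : Type*} {D : Set E} {ε : ℝ} (hε : 0 < ε)
    (hD : ∀ x ∈ Submodule.span ℝ D, ‖x‖ < ε → x ∈ D) {a : ι → E}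
    (ha : ∀ x ∈ D, ∃ C, ∀ i, inner ℝ (a i) x ≤ C) :
    ∃ C, ∀ i, ∀ x ∈ Submodule.span ℝ D, |inner ℝ (a i) x| ≤ C * ‖x‖ := by
  have h1 : ∀ x ∈ Submodule.span ℝ D, ∃ C, ∀ i, inner ℝ (a i) x ≤ C := by
    intro x hx
    set t := ε / (2 * (‖x‖ + 1)) with ht
    have htpos : 0 < t := by positivity
    have hlt : ‖t • x‖ < ε := by
      rw [norm_smul, Real.norm_of_nonneg htpos.le, ht, div_mul_eq_mul_div, div_lt_iff₀
        (by positivity)]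
      nlinarith [norm_nonneg x]
    obtain ⟨C, hC⟩ := ha _ (hD _ (Submodule.smul_mem _ t hx) hlt)
    refine ⟨C / t, fun i => ?_⟩
    rw [le_div_iff₀ htpos, mul_comm, ← real_inner_smul_right]
    exact hC i
  let g : ι → Submodule.span ℝ D →L[ℝ] ℝ := fun i =>
    (innerSL ℝ (a i)).comp (Submodule.span ℝ D).subtypeL
  obtain ⟨C, hC⟩ := banach_steinhaus (g := g) (by
    rintro ⟨x, hx⟩
    obtain ⟨C₁, hC₁⟩ := h1 x hx
    obtain ⟨C₂, hC₂⟩ := h1 (-x) (Submodule.neg_mem _ hx)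
    refine ⟨max C₁ C₂, fun i => ?_⟩
    have h2 := hC₂ i
    rw [inner_neg_right] at h2
    exact abs_le'.2 ⟨(hC₁ i).trans (le_max_left _ _), h2.trans (le_max_right _ _)⟩)
  exact ⟨C, fun i x hx => (g i).le_of_opNorm_le (hC i) ⟨x, hx⟩⟩

theorem exists_norm_bound [FiniteDimensional ℝ E] {ι : Type*} {D : Set E} (hD : (0 : E) ∈ interior D)
    {a : ι → E} (ha : ∀ x ∈ D, ∃ C, ∀ i, inner ℝ (a i) x ≤ C) : ∃ C, ∀ i, ‖a i‖ ≤ C := by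
  obtain ⟨ε, hε, hball⟩ := Metric.mem_nhds_iff.1 (mem_interior_iff_mem_nhds.1 hD)
  have hmem : ∀ x : E, ‖x‖ < ε → x ∈ D := fun x hx => hball (by simpa using hx)
  have hspan : ∀ x : E, x ∈ Submodule.span ℝ D := by
    intro x
    set t := ε / (2 * (‖x‖ + 1)) with ht
    have htpos : 0 < t := by positivity
    have hlt : ‖t • x‖ < ε := by
      rw [norm_smul, Real.norm_of_nonneg htpos.le, ht, div_mul_eq_mul_div, div_lt_iff₀
        (by positivity)]
      nlinarith [norm_nonneg x]
    exact (Submodule.smul_mem_iff _ htpos.ne').1 (Submodule.subset_span (hmem _ hlt))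
  obtain ⟨C, hC⟩ := exists_bound_on_span hε (fun x _ hx => hmem x hx) ha
  refine ⟨max C 0, fun i => ?_⟩
  have h := (le_abs_self _).trans (hC i (a i) (hspan _))
  rw [real_inner_self_eq_norm_sq] at h
  rcases eq_or_lt_of_le (norm_nonneg (a i)) with h0 | h0
  · rw [← h0]; exact le_max_right _ _
  · exact le_max_of_le_left (le_of_mul_le_mul_right (by rwa [← sq]) h0)

/-! ### The dual cost -/

theorem coe_le_conj {h : E → EReal} (hb : ∀ x, h x ≠ ⊥) {x : E} (hx : x ∈ dom h) (y : E) :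
    ((inner ℝ y x - (h x).toReal : ℝ) : EReal) ≤ conj h y := by
  rw [EReal.coe_sub, coe_toReal_of_mem_dom hb hx]
  exact le_iSup (fun x => ((inner ℝ y x : ℝ) : EReal) - h x) x

theorem conj_le_coe {h : E → EReal} (hb : ∀ x, h x ≠ ⊥) {y : E} {r : ℝ}
    (hr : ∀ x ∈ dom h, inner ℝ y x - (h x).toReal ≤ r) : conj h y ≤ (r : EReal) := by
  refine iSup_le fun x => ?_
  by_cases hx : x ∈ dom h
  · rw [← coe_toReal_of_mem_dom hb hx, ← EReal.coe_sub]
    exact EReal.coe_le_coe_iff.2 (hr x hx)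
  · rw [mem_dom_iff, not_not] at hx
    rw [hx, EReal.sub_top]
    exact bot_le

section StrongCase

variable {φ₁ φ₂ : E → EReal} {μ γ lam c : ℝ}

/-- The sum of two Fenchel–Young inequalities, at `-x₁` and `x₂`. -/
theorem coe_le_dualCost (hb₁ : ∀ x, φ₁ x ≠ ⊥) (hb₂ : ∀ x, φ₂ x ≠ ⊥) {x₁ x₂ : E}
    (hx₁ : x₁ ∈ dom φ₁) (hx₂ : x₂ ∈ dom φ₂) (y : E) :
    ((-inner ℝ y (x₁ - x₂) - (φ₁ x₁).toReal - (φ₂ x₂).toReal : ℝ) : EReal) ≤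
      dualCost φ₁ φ₂ y := by
  have h₁ := coe_le_conj (h := fun x => φ₁ (-x)) (fun x => hb₁ _) (x := -x₁)
    (by rw [mem_dom_iff, neg_neg]; exact mem_dom_iff.1 hx₁) y
  have h₂ := coe_le_conj hb₂ hx₂ y
  refine le_trans (le_of_eq ?_) (add_le_add h₁ h₂)
  rw [← EReal.coe_add, neg_neg, inner_neg_right, inner_sub_right]
  congr 1
  ring

theorem dualCost_le_coe (hb₁ : ∀ x, φ₁ x ≠ ⊥) (hb₂ : ∀ x, φ₂ x ≠ ⊥) {y : E} {r₁ r₂ : ℝ}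
    (hr₁ : ∀ x ∈ dom φ₁, -inner ℝ y x - (φ₁ x).toReal ≤ r₁)
    (hr₂ : ∀ x ∈ dom φ₂, inner ℝ y x - (φ₂ x).toReal ≤ r₂) :
    dualCost φ₁ φ₂ y ≤ ((r₁ + r₂ : ℝ) : EReal) := by
  rw [EReal.coe_add]
  refine add_le_add (conj_le_coe (fun x => hb₁ _) fun x hx => ?_) (conj_le_coe hb₂ hr₂)
  have := hr₁ (-x) hx
  rwa [inner_neg_right, neg_neg] at this

/-- Interiority of `0` in `dom φ₁ - dom φ₂` makes the dual cost level bounded. -/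
theorem levelBounded_dualCost [FiniteDimensional ℝ E] (hb₁ : ∀ x, φ₁ x ≠ ⊥)
    (hb₂ : ∀ x, φ₂ x ≠ ⊥) (h0 : (0 : E) ∈ interior (dom φ₁ - dom φ₂)) :
    LevelBounded (dualCost φ₁ φ₂) := by
  intro α
  obtain ⟨C, hC⟩ := exists_norm_bound (ι := {y | dualCost φ₁ φ₂ y ≤ (α : EReal)})
    (a := fun y => -(y : E)) h0 (by
      rintro _ ⟨x₁, hx₁, x₂, hx₂, rfl⟩
      refine ⟨α + (φ₁ x₁).toReal + (φ₂ x₂).toReal, fun y => ?_⟩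
      have := (coe_le_dualCost hb₁ hb₂ hx₁ hx₂ y).trans y.2
      rw [EReal.coe_le_coe_iff] at this
      simp only [inner_neg_left]
      linarith)
  refine isBounded_iff_forall_norm_le.2 ⟨C, fun y hy => ?_⟩
  have := hC ⟨y, hy⟩
  rwa [norm_neg] at this

/-- If the dual cost is finite somewhere and level bounded, then `dom φ₁ - dom φ₂` spans. -/
theorem span_eq_top_of_levelBounded [FiniteDimensional ℝ E] (hb₁ : ∀ x, φ₁ x ≠ ⊥)
    (hb₂ : ∀ x, φ₂ x ≠ ⊥) (hne₁ : (dom φ₁).Nonempty) (hne₂ : (dom φ₂).Nonempty)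
    {y₀ : E} {r₁ r₂ : ℝ}
    (hr₁ : ∀ x ∈ dom φ₁, -inner ℝ y₀ x - (φ₁ x).toReal ≤ r₁)
    (hr₂ : ∀ x ∈ dom φ₂, inner ℝ y₀ x - (φ₂ x).toReal ≤ r₂)
    (hlev : LevelBounded (dualCost φ₁ φ₂)) : Submodule.span ℝ (dom φ₁ - dom φ₂) = ⊤ := by
  by_contra hV
  rw [← Submodule.orthogonal_eq_bot_iff] at hV
  obtain ⟨y, hy, hyne⟩ := Submodule.exists_mem_ne_zero_of_ne_bot hV
  have hconst : ∀ x₁ ∈ dom φ₁, ∀ x₂ ∈ dom φ₂, inner ℝ y x₁ = inner ℝ y x₂ := by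
    intro x₁ hx₁ x₂ hx₂
    have := (Submodule.mem_orthogonal' _ _).1 hy (x₁ - x₂)
      (Submodule.subset_span (Set.sub_mem_sub hx₁ hx₂))
    rwa [inner_sub_right, sub_eq_zero] at this
  obtain ⟨z₁, hz₁⟩ := hne₁
  obtain ⟨z₂, hz₂⟩ := hne₂
  -- Orthogonality makes `⟪y, ·⟫` take one common constant value on both domains, so moving along
  -- `y` shifts the two conjugate bounds by opposite amounts and a whole line lies in one sublevel
  -- set.
  have hle : ∀ t : ℝ, dualCost φ₁ φ₂ (y₀ + t • y) ≤ ((r₁ + r₂ : ℝ) : EReal) := by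
    intro t
    have := dualCost_le_coe hb₁ hb₂ (y := y₀ + t • y) (r₁ := r₁ - t * inner ℝ y z₂)
      (r₂ := r₂ + t * inner ℝ y z₂)
      (fun x hx => by
        rw [inner_add_left, real_inner_smul_left, hconst x hx z₂ hz₂]
        linarith [hr₁ x hx])
      (fun x hx => by
        rw [inner_add_left, real_inner_smul_left, ← hconst z₁ hz₁ x hx, hconst z₁ hz₁ z₂ hz₂]
        linarith [hr₂ x hx])
    rwa [sub_add_add_cancel] at this
  obtain ⟨C, hC⟩ := isBounded_iff_forall_norm_le.1 (hlev (r₁ + r₂))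
  have hpos : 0 < ‖y‖ := norm_pos_iff.2 hyne
  have h1 := hC _ (hle ((|C| + ‖y₀‖ + 1) / ‖y‖))
  have h2 := norm_sub_norm_le (((|C| + ‖y₀‖ + 1) / ‖y‖) • y) (-y₀)
  rw [sub_neg_eq_add, norm_neg, add_comm _ y₀, norm_smul, Real.norm_of_nonneg (by positivity),
    div_mul_cancel₀ _ hpos.ne'] at h2
  linarith [le_abs_self C]

theorem levelBounded_dualCost_iff [FiniteDimensional ℝ E] (hS : StronglyConvexCase φ₁ φ₂ μ)
    (hγ : 0 < γ) {s u v : E} (h : (u, v) ∈ drs φ₁ φ₂ γ s) :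
    (0 : E) ∈ interior (dom φ₁ - dom φ₂) ↔ LevelBounded (dualCost φ₁ φ₂) := by
  have hb₁ := hS.proper₁.ne_bot
  have hb₂ := hS.proper₂.ne_bot
  refine ⟨levelBounded_dualCost hb₁ hb₂, fun hlev => ?_⟩
  have hμ := hS.pos
  have htop := span_eq_top_of_levelBounded hb₁ hb₂ hS.proper₁.nonempty_dom
    hS.proper₂.nonempty_dom
    -- This is a subgradient of `φ₂` at `v`, which gives `r₂`. Its negative differs from the
    -- subgradient `(s - u) / γ` of `φ₁` at `u` by `(u - v) / γ`; strong convexity absorbs the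
    -- difference by completing a square, whence `r₁`.
    (y₀ := (1 / γ) • ((2 : ℝ) • u - s - v))
    (r₁ := -inner ℝ ((1 / γ) • ((2 : ℝ) • u - s - v)) u - (φ₁ u).toReal +
      ‖(1 / γ) • (u - v)‖ ^ 2 / (2 * μ))
    (r₂ := inner ℝ ((1 / γ) • ((2 : ℝ) • u - s - v)) v - (φ₂ v).toReal)
    (fun x hx => by
      have h₁ := prox_minorant hb₁ hγ hS.strong h.1 hx
      simp only at h₁
      rw [← real_inner_smul_left] at h₁
      have e : (1 / γ) • ((2 : ℝ) • u - s - v) = (1 / γ) • (u - v) - (1 / γ) • (s - u) := by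
        module
      rw [e]
      set b := (1 / γ) • (u - v)
      set a := (1 / γ) • (s - u)
      obtain ⟨z, rfl⟩ : ∃ z, x = u + z := ⟨x - u, by abel⟩
      rw [add_sub_cancel_left] at h₁
      rw [inner_add_right, inner_sub_left b a z]
      have hsq : 0 ≤ ‖b + μ • z‖ ^ 2 / (2 * μ) := by positivity
      rw [norm_add_sq_real, norm_smul μ z, real_inner_smul_right, Real.norm_of_nonneg hμ.le] at hsq
      have e2 : (‖b‖ ^ 2 + 2 * (μ * inner ℝ b z) + (μ * ‖z‖) ^ 2) / (2 * μ) =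
          ‖b‖ ^ 2 / (2 * μ) + inner ℝ b z + μ / 2 * ‖z‖ ^ 2 := by
        field_simp
      rw [e2] at hsq
      linarith)
    (fun x hx => by
      have h₂ := prox_minorant_of_convex hb₂ hS.convex hγ h.2 hx
      simp only at h₂
      rw [← real_inner_smul_left, inner_sub_right] at h₂
      linarith)
    hlev
  obtain ⟨ε, hε, hball⟩ := exists_ball_subset_of_mem_intrinsicInterior hS.qualification
  refine mem_interior_iff_mem_nhds.2 (Metric.mem_nhds_iff.2 ⟨ε, hε, fun x hx => ?_⟩)
  exact hball x (htop ▸ Submodule.mem_top) (by simpa using hx)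

/-! ### Convergence in the strongly convex case -/

/-- Stated on the product because `φ₁` is evaluated along `u` and `φ₂` along `v`. -/
theorem lowerSemicontinuous_add_prod {φ₁ φ₂ : E → EReal} (h₁ : LowerSemicontinuous φ₁)
    (h₂ : LowerSemicontinuous φ₂) (hb₁ : ∀ x, φ₁ x ≠ ⊥) (hb₂ : ∀ x, φ₂ x ≠ ⊥) :
    LowerSemicontinuous fun z : E × E => φ₁ z.1 + φ₂ z.2 :=
  (h₁.comp continuous_fst).add' (h₂.comp continuous_snd) fun z =>
    EReal.continuousAt_add (.inr (hb₂ z.2)) (.inl (hb₁ z.1))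

/-- Monotonicity and the quadratic gap carry the argument; existence of a minimizer is a conclusion,
obtained from a cluster point of `u`. -/
theorem strong_convergence [FiniteDimensional ℝ E] {imax : ℕ∞} {s u v : ℕ → E} (hγ : 0 < γ)
    (hlam : 0 < lam) (hc : 0 < c) (hS : StronglyConvexCase φ₁ φ₂ μ) (hμγ : 1 / μ < γ)
    (hcC : c < decreaseConst True (1 / (γ * μ)) lam)
    (hrun : IsRun φ₁ φ₂ (-1) γ lam c 0 imax s u v) :
    Summable (fun k => ‖u k - v k‖ ^ 2) ∧
    (∃ xstar, argmin (φ₁ + φ₂) = {xstar} ∧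
      Monotone (fun k => dre φ₁ φ₂ γ (s k) (u k) (v k)) ∧
      Tendsto (fun k => dre φ₁ φ₂ γ (s k) (u k) (v k)) atTop (𝓝 ((φ₁ + φ₂) xstar)) ∧
      Tendsto u atTop (𝓝 xstar) ∧ Tendsto v atTop (𝓝 xstar)) ∧
    ((0 : E) ∈ interior (dom φ₁ - dom φ₂) → Bornology.IsBounded (Set.range s)) := by
  have hb₁ := hS.proper₁.ne_bot
  have hb₂ := hS.proper₂.ne_bot
  have hμ := hS.pos
  have hmem := hrun.mem_drs
  have hudom := fun k => (dom_of_mem_drs hb₁ hb₂ (hmem k)).1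
  have hvdom := fun k => (dom_of_mem_drs hb₁ hb₂ (hmem k)).2
  set D : ℕ → ℝ := fun k => dreReal φ₁ φ₂ γ (s k) (u k) (v k) with hD
  have hdec := hrun.decrease hb₁ hb₂ hγ fun s u v u' v' h h' => by
    have := nominal_increase_of_strong hS hγ hlam hc hcC h h'
    linarith
  obtain ⟨κ, hκ, hκeq⟩ : ∃ κ > 0, κ = μ / 2 - 1 / (2 * γ) := by
    refine ⟨_, ?_, rfl⟩
    rw [gt_iff_lt, sub_pos, div_lt_div_iff₀ (by positivity) two_pos]
    rw [div_lt_iff₀ hμ] at hμγ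
    linarith
  have hgap : ∀ w, w ∈ dom φ₁ → w ∈ dom φ₂ → ∀ k,
      D k + κ * ‖w - u k‖ ^ 2 ≤ (φ₁ w).toReal + (φ₂ w).toReal := fun w h₁ h₂ k => by
    rw [hκeq]; exact dreReal_add_le_of_strong hS hγ (hmem k) h₁ h₂
  obtain ⟨w, hw₁, w', hw₂, hww⟩ := intrinsicInterior_subset hS.qualification
  obtain rfl : w = w' := sub_eq_zero.1 hww
  have hup : ∀ k, D k ≤ (φ₁ w).toReal + (φ₂ w).toReal := fun k =>
    le_trans (le_add_of_nonneg_right (by positivity)) (hgap w hw₁ hw₂ k)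
  obtain ⟨hsq, hanti, l', hl'⟩ := summable_and_antitone_of_decrease
    (a := fun k => -1 * D k) (div_pos hc hγ) (fun k => sq_nonneg _) (fun k => by rw [neg_one_mul]; exact neg_le_neg (hup k)) hdec
  have hmono : Monotone D := fun i j hij => by
    have := hanti hij
    simp only [neg_one_mul] at this
    exact neg_le_neg_iff.1 this
  obtain ⟨l, hl⟩ : ∃ l, Tendsto D atTop (𝓝 l) :=
    ⟨-l', by simpa [hD] using hl'.neg⟩
  have hr : Tendsto (fun k => u k - v k) atTop (𝓝 0) := tendsto_of_summable_norm_sq hsq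
  -- boundedness of the primal iterates
  have hub : Bornology.IsBounded (Set.range u) := by
    have hbd : ∀ k, ‖w - u k‖ ≤ 1 + ((φ₁ w).toReal + (φ₂ w).toReal - D 0) / κ := fun k => by
      have h1 : ‖w - u k‖ ^ 2 ≤ ((φ₁ w).toReal + (φ₂ w).toReal - D 0) / κ := by
        rw [le_div_iff₀ hκ]
        linarith [hgap w hw₁ hw₂ k, hmono (Nat.zero_le k)]
      nlinarith [sq_nonneg (‖w - u k‖ - 1), norm_nonneg (w - u k)]
    refine (Metric.isBounded_closedBall (x := w)
      (r := 1 + ((φ₁ w).toReal + (φ₂ w).toReal - D 0) / κ)).subset ?_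
    rintro _ ⟨k, rfl⟩
    rw [Metric.mem_closedBall, dist_comm, dist_eq_norm]
    exact hbd k
  have hrb := Metric.isBounded_range_of_tendsto _ hr
  obtain ⟨R, hR⟩ := isBounded_iff_forall_norm_le.1 hrb
  have hvb : Bornology.IsBounded (Set.range v) :=
    isBounded_range_add (y := fun k => -(u k - v k)) hub
      (Metric.isBounded_range_of_tendsto _ hr.neg) fun k => by abel
  obtain ⟨M, hM⟩ := isBounded_iff_forall_norm_le.1 hvb
  -- boundedness of the dual iterates in the directions of `dom φ₁ - dom φ₂`
  have ha : ∀ x ∈ dom φ₁ - dom φ₂, ∃ C, ∀ k, inner ℝ (s k - u k) x ≤ C := by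
    rintro _ ⟨x₁, hx₁, x₂, hx₂, rfl⟩
    refine ⟨γ * ((φ₁ x₁).toReal + (φ₂ x₂).toReal - D 0) + R ^ 2 / 2 + R * (M + ‖x₂‖),
      fun k => ?_⟩
    have h1 := inner_sub_le_of_strong hS hγ (hmem k) hx₁ hx₂
    have h2 : ‖u k - v k‖ ≤ R := hR _ ⟨k, rfl⟩
    have h3 : ‖v k‖ ≤ M := hM _ ⟨k, rfl⟩
    have h4 : inner ℝ (u k - v k) (v k - x₂) ≤ R * (M + ‖x₂‖) :=
      (real_inner_le_norm _ _).trans (mul_le_mul h2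
        ((norm_sub_le _ _).trans (by linarith)) (norm_nonneg _) ((norm_nonneg _).trans h2))
    have h5 : ‖u k - v k‖ ^ 2 ≤ R ^ 2 := pow_le_pow_left₀ (norm_nonneg _) h2 2
    have h6 : γ * ((φ₁ x₁).toReal + (φ₂ x₂).toReal - D k) ≤
        γ * ((φ₁ x₁).toReal + (φ₂ x₂).toReal - D 0) :=
      mul_le_mul_of_nonneg_left (by linarith [hmono (Nat.zero_le k)]) hγ.le
    simp only [hD] at h6 ⊢
    linarith
  obtain ⟨ε, hε, hball⟩ := exists_ball_subset_of_mem_intrinsicInterior hS.qualification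
  obtain ⟨C, hC⟩ := exists_bound_on_span hε hball ha
  -- Here `s k - u k` may be unbounded, but `u k - v k` lies in `dom φ₁ - dom φ₂`, where the uniform
  -- bound applies.
  have har : Tendsto (fun k => inner ℝ (s k - u k) (u k - v k)) atTop (𝓝 0) := by
    refine squeeze_zero_norm (fun k => hC k (u k - v k)
      (Submodule.subset_span (Set.sub_mem_sub (hudom k) (hvdom k)))) ?_
    simpa using hr.norm.const_mul C
  have hvals : Tendsto (fun k => (φ₁ (u k)).toReal + (φ₂ (v k)).toReal) atTop (𝓝 l) := by
    have h1 := (hl.add (har.const_mul (1 / γ))).sub ((hr.norm.pow 2).const_mul (1 / (2 * γ)))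
    rw [mul_zero, add_zero, norm_zero, zero_pow two_ne_zero, mul_zero, sub_zero] at h1
    refine h1.congr fun k => ?_
    simp only [hD, dreReal]
    rw [← neg_sub (u k) (v k), inner_neg_right, norm_neg]
    ring
  obtain ⟨x, -, ψ, hψ, hψx⟩ := tendsto_subseq_of_bounded hub fun k => Set.mem_range_self k
  have hψv := hψx.sub (hr.comp hψ.tendsto_atTop)
  simp only [Function.comp_def, sub_sub_cancel, sub_zero] at hψv
  have hxl : (φ₁ + φ₂) x ≤ (l : EReal) :=
    le_of_tendsto_of_lsc (lowerSemicontinuous_add_prod hS.proper₁.lsc hS.proper₂.lsc hb₁ hb₂)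
      (hψx.prodMk_nhds hψv) (hvals.comp hψ.tendsto_atTop) fun k => by
        simp only [Function.comp_def, EReal.coe_add]
        rw [coe_toReal_of_mem_dom hb₁ (hudom _), coe_toReal_of_mem_dom hb₂ (hvdom _)]
  obtain ⟨hx₁, hx₂⟩ := (mem_dom_add hb₁ hb₂).1
    (mem_dom_iff.2 (ne_top_of_le_ne_top (EReal.coe_ne_top _) hxl))
  have hxeq := toReal_add_of_mem_dom hb₁ hb₂ hx₁ hx₂
  rw [hxeq, EReal.coe_le_coe_iff] at hxl
  have hlle : ∀ y, y ∈ dom φ₁ → y ∈ dom φ₂ → l ≤ (φ₁ y).toReal + (φ₂ y).toReal := fun y h₁ h₂ =>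
    le_of_tendsto' hl fun k => le_trans (le_add_of_nonneg_right (by positivity)) (hgap y h₁ h₂ k)
  have hxl' : (φ₁ x).toReal + (φ₂ x).toReal = l := le_antisymm hxl (hlle x hx₁ hx₂)
  have hargmin : ∀ y, y ∈ argmin (φ₁ + φ₂) ↔
      y ∈ dom φ₁ ∧ y ∈ dom φ₂ ∧ (φ₁ y).toReal + (φ₂ y).toReal = l := by
    intro y
    rw [mem_argmin_iff (add_ne_bot hb₁ hb₂), mem_dom_add hb₁ hb₂, and_assoc]
    refine and_congr_right fun hy₁ => and_congr_right fun hy₂ => ⟨fun H => ?_, fun H z hz => ?_⟩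
    · have := H x ((mem_dom_add hb₁ hb₂).2 ⟨hx₁, hx₂⟩)
      rw [hxeq, toReal_add_of_mem_dom hb₁ hb₂ hy₁ hy₂, EReal.toReal_coe, EReal.toReal_coe,
        hxl'] at this
      exact le_antisymm this (hlle y hy₁ hy₂)
    · obtain ⟨hz₁, hz₂⟩ := (mem_dom_add hb₁ hb₂).1 hz
      rw [toReal_add_of_mem_dom hb₁ hb₂ hy₁ hy₂, toReal_add_of_mem_dom hb₁ hb₂ hz₁ hz₂,
        EReal.toReal_coe, EReal.toReal_coe, H]
      exact hlle z hz₁ hz₂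
  -- At a minimizer the gap reads `κ * ‖y - u k‖ ^ 2 ≤ l - D k → 0`. This gives both full
  -- convergence and, by uniqueness of limits, uniqueness of the minimizer.
  have hconv : ∀ y, y ∈ argmin (φ₁ + φ₂) → Tendsto u atTop (𝓝 y) := by
    intro y hy
    obtain ⟨hy₁, hy₂, hyl⟩ := (hargmin y).1 hy
    rw [tendsto_iff_norm_sub_tendsto_zero]
    have h1 : Tendsto (fun k => (l - D k) / κ) atTop (𝓝 0) := by
      simpa using (hl.const_sub l).div_const κ
    have h2 := (Real.continuous_sqrt.tendsto 0).comp h1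
    rw [Real.sqrt_zero] at h2
    refine squeeze_zero (fun k => norm_nonneg _) (fun k => ?_) h2
    refine Real.le_sqrt_of_sq_le ?_
    rw [le_div_iff₀ hκ, norm_sub_rev]
    linarith [hgap y hy₁ hy₂ k]
  have hxmin : x ∈ argmin (φ₁ + φ₂) := (hargmin x).2 ⟨hx₁, hx₂, hxl'⟩
  have hux := hconv x hxmin
  have hdre : (fun k => dre φ₁ φ₂ γ (s k) (u k) (v k)) = fun k => (D k : EReal) :=
    funext fun k => dre_eq_coe_of_mem_drs hb₁ hb₂ (hmem k)
  refine ⟨hsq, ⟨x, Set.eq_singleton_iff_unique_mem.2 ⟨hxmin, fun y hy =>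
    tendsto_nhds_unique (hconv y hy) hux⟩, ?_, ?_, hux, ?_⟩, fun hint => ?_⟩
  · rw [hdre]; exact fun i j hij => EReal.coe_le_coe_iff.2 (hmono hij)
  · rw [hdre, hxeq, hxl']; exact (continuous_coe_real_ereal.tendsto l).comp hl
  · simpa using hux.sub hr
  · obtain ⟨K, hK⟩ := exists_norm_bound hint ha
    refine isBounded_range_add (y := fun k => s k - u k) hub
      (isBounded_iff_forall_norm_le.2 ⟨K, ?_⟩) fun k => by abel
    rintro _ ⟨k, rfl⟩
    exact hK k

end StrongCase

end LinesearchDRS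

end

open LinesearchDRS in
theorem mainTheorem2 (p : ℕ) (φ₁ φ₂ : EuclideanSpace ℝ (Fin p) → EReal)
    (γ lam c : ℝ) (imax : ℕ∞) (s u v : ℕ → EuclideanSpace ℝ (Fin p))
    (hγ : 0 < γ) (hlam : 0 < lam) (hlam' : lam < 2) (hc : 0 < c) :
    -- the smooth case
    (∀ L : ℝ≥0, SmoothCase φ₁ φ₂ L → StepsizeCond φ₁ L γ lam →
      c < decreaseConst (IsConvexFun φ₁) (γ * L) lam →
      IsRun φ₁ φ₂ 1 γ lam c 0 imax s u v →
        Summable (fun k => ‖u k - v k‖ ^ 2) ∧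
        (∃ φlim : ℝ,
          Antitone (fun k => dre φ₁ φ₂ γ (s k) (u k) (v k)) ∧
          Tendsto (fun k => dre φ₁ φ₂ γ (s k) (u k) (v k)) atTop (𝓝 (φlim : EReal)) ∧
          (∀ x, MapClusterPt x atTop u ↔ MapClusterPt x atTop v) ∧
          (∀ x, MapClusterPt x atTop u →
            IsStationary (φ₁ + φ₂) x ∧ (φ₁ + φ₂) x = (φlim : EReal) ∧
            ∃ sbar, MapClusterPt sbar atTop s ∧ prox γ φ₁ sbar = {x} ∧
              (x, x) ∈ drs φ₁ φ₂ γ sbar ∧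
              ∀ w ∈ drs φ₁ φ₂ γ sbar, dre φ₁ φ₂ γ sbar w.1 w.2 = (φlim : EReal))) ∧
        (LevelBounded (φ₁ + φ₂) →
          Bornology.IsBounded (Set.range s) ∧ Bornology.IsBounded (Set.range u) ∧
          Bornology.IsBounded (Set.range v))) ∧
    -- the strongly convex case
    (∀ μ : ℝ, StronglyConvexCase φ₁ φ₂ μ → 1 / μ < γ →
      c < decreaseConst True (1 / (γ * μ)) lam →
      IsRun φ₁ φ₂ (-1) γ lam c 0 imax s u v →
        Summable (fun k => ‖u k - v k‖ ^ 2) ∧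
        (∃ xstar, argmin (φ₁ + φ₂) = {xstar} ∧
          Monotone (fun k => dre φ₁ φ₂ γ (s k) (u k) (v k)) ∧
          Tendsto (fun k => dre φ₁ φ₂ γ (s k) (u k) (v k)) atTop (𝓝 ((φ₁ + φ₂) xstar)) ∧
          Tendsto u atTop (𝓝 xstar) ∧ Tendsto v atTop (𝓝 xstar)) ∧
        ((0 : EuclideanSpace ℝ (Fin p)) ∈ interior (dom φ₁ - dom φ₂) ↔
          LevelBounded (dualCost φ₁ φ₂)) ∧
        ((0 : EuclideanSpace ℝ (Fin p)) ∈ interior (dom φ₁ - dom φ₂) →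
          Bornology.IsBounded (Set.range s))) := by
  refine ⟨fun L hS hstep hcC hrun => smooth_convergence hγ hlam hc hS hstep hcC hrun,
    fun μ hS hμγ hcC hrun => ?_⟩
  obtain ⟨h1, h2, h3⟩ := strong_convergence hγ hlam hc hS hμγ hcC hrun
  exact ⟨h1, h2, levelBounded_dualCost_iff hS hγ hrun.init, h3⟩
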